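/- **Theorem (the weight $W_d$ is an invariant for equidecomposability).** A *rational polygon* is a compact set $P\subset\mathbb R^2$ that is the closure of its interior and whose boundary is the union of finitely many non-degenerate segments with rational endpoints (the edges; their endpoints are the vertices), such that two different edges have at most endpoints of both in common. It need not be convex. It is *integral* if these segments can be chosen with endpoints in $\mathbb Z^2$. The *denominator* of $P$ is the least integer $N\ge 1$ such that $NP$ is integral. Two sets $P,Q\subset\mathbb R^2$ are *finitely and rationally discretely equidecomposable* if there are finitely many open simplices $T_1,\dots,T_r$ (points, open segments, open triangles) with rational vertices, and maps $g_i(x)=U_ix+v_i$ with $U_i\in GL_2(\mathbb Z)$ and $v_i\in\mathbb Z^2$, such that $$P=\bigsqcup_{i=1}^r T_i,\qquad Q=\bigsqcup_{i=1}^r g_i(T_i)\qquad\text{(disjoint unions)}.$$ Let $d\ge1$ and $\mathcal L_d=\frac1d\mathbb Z\times\frac1d\mathbb Z$. A non-degenerate segment is *$d$-minimal* if its intersection with $\mathcal L_d$ consists precisely of its two endpoints. The *weight* of the oriented $d$-minimal segment from $(\frac wd,\frac xd)$ to $(\frac yd,\frac zd)$ is $$\det\begin{pmatrix} w&y\\x&z\end{pmatrix}\bmod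 d\ \in\ \mathbb Z/d\mathbb Z .$$ If $P$ is a rational polygon whose denominator divides $d$, its boundary, oriented counterclockwise (that is, with the interior of $P$ on the left), decomposes uniquely into oriented $d$-minimal segments, and $W_d(P)$ is the multiset of their weights. Let $P$ and $Q$ be rational polygons whose denominators divide $d$ (for example, both of denominator $d$). If $P$ and $Q$ are finitely and rationally discretely equidecomposable, then $$W_d(P)=W_d(Q)$$ as multisets of elements of $\mathbb Z/d\mathbb Z$. -/

import Mathlib

open Set Topology
open scoped Pointwise Matrix

noncomputable section

namespace Equidecomp

/-- The plane `ℝ²` (only its topology and its affine structure are used). -/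
abbrev Plane : Type := Fin 2 → ℝ

/-! ### Lattices and rational points -/

/-- The point `(a₀/d, a₁/d)` of the lattice `(1/d)ℤ × (1/d)ℤ`. -/
def latticePoint (d : ℕ) (a : Fin 2 → ℤ) : Plane := fun i => (a i : ℝ) / (d : ℝ)

/-- The lattice `(1/d)ℤ × (1/d)ℤ`. -/
def lattice (d : ℕ) : Set Plane := range (latticePoint d)

/-- The points of the plane with rational coordinates. -/
def rationalPoints : Set Plane := range fun (a : Fin 2 → ℚ) (i : Fin 2) => (a i : ℝ)

/-! ### Polygons -/

/-- `P` is a polygon, not necessarily convex, all of whose vertices lie in `V`: a compact set that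
is the closure of its interior and whose boundary consists of finitely many non-degenerate
segments (the edges) with end points in `V`, two different edges having no points in common except
possibly end points of both. The region enclosed by a simple closed polygonal curve is of this
form; holes and several components are allowed. -/
def IsPolygonOver (V : Set Plane) (P : Set Plane) : Prop :=
  IsCompact P ∧ closure (interior P) = P ∧
    ∃ S : Finset (Plane × Plane),
      (∀ e ∈ S, e.1 ∈ V ∧ e.2 ∈ V ∧ e.1 ≠ e.2) ∧
      (∀ e ∈ S, ∀ f ∈ S, e ≠ f →
        segment ℝ e.1 e.2 ∩ segment ℝ f.1 f.2 ⊆ {e.1, e.2} ∩ {f.1, f.2}) ∧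
      frontier P = ⋃ e ∈ S, segment ℝ e.1 e.2

/-- A rational polygon: a polygon all of whose vertices have rational coordinates. -/
structure RationalPolygon where
  /-- the underlying set of points -/
  carrier : Set Plane
  isPolygon : IsPolygonOver rationalPoints carrier

/-- An integral polygon: a polygon all of whose vertices lie in `ℤ × ℤ`. -/
def IsIntegralPolygon (P : Set Plane) : Prop := IsPolygonOver (lattice 1) P

/-- The denominator of `P`: the least positive integer `N` such that the dilate `N P` is an
integral polygon. -/
def RationalPolygon.denominator (P : RationalPolygon) : ℕ :=
  sInf {N : ℕ | 0 < N ∧ IsIntegralPolygon ((N : ℝ) • P.carrier)}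

/-! ### Finite rational discrete equidecomposability -/

/-- The transformation `x ↦ U x + v` of the plane induced by the element `(U, v)` of the affine
unimodular group `GL₂(ℤ) ⋉ ℤ²`. -/
def gMap (U : GL (Fin 2) ℤ) (v : Fin 2 → ℤ) (x : Plane) : Plane :=
  (U.val.map fun z : ℤ => (z : ℝ)) *ᵥ x + fun i => (v i : ℝ)

/-- The open simplex spanned by points `p 0, …, p k`: all convex combinations of the `p i` with
strictly positive coefficients. For `k = 0` it is the point `p 0`. -/
def openSimplex {k : ℕ} (p : Fin (k + 1) → Plane) : Set Plane :=
  {x | ∃ w : Fin (k + 1) → ℝ, (∀ i, 0 < w i) ∧ ∑ i, w i = 1 ∧ ∑ i, w i • p i = x}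

/-- `T` is an open simplex (a point, an open segment or an open triangle) with rational
vertices. -/
def IsRationalOpenSimplex (T : Set Plane) : Prop :=
  ∃ (k : ℕ) (p : Fin (k + 1) → Plane),
    (∀ i, p i ∈ rationalPoints) ∧ AffineIndependent ℝ p ∧ T = openSimplex p

/-- `P` and `Q` are finitely and rationally discretely equidecomposable: `P` is a disjoint union of
finitely many rational open simplices `T i`, and `Q` is the disjoint union of their images under
suitable transformations from the affine unimodular group. -/
def FinRatEquidecomposable (P Q : Set Plane) : Prop :=
  ∃ (r : ℕ) (T : Fin r → Set Plane) (U : Fin r → GL (Fin 2) ℤ) (v : Fin r → Fin 2 → ℤ),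
    (∀ i, IsRationalOpenSimplex (T i)) ∧
    (Pairwise fun i j => Disjoint (T i) (T j)) ∧ P = ⋃ i, T i ∧
    (Pairwise fun i j => Disjoint (gMap (U i) (v i) '' T i) (gMap (U j) (v j) '' T j)) ∧
    Q = ⋃ i, gMap (U i) (v i) '' T i

/-! ### Weights -/

/-- The segment from `p` to `q` is `d`-minimal: it is non-degenerate, and its points in the lattice
`(1/d)ℤ × (1/d)ℤ` are precisely its end points. -/
def IsMinimalSegment (d : ℕ) (p q : Plane) : Prop :=
  p ≠ q ∧ segment ℝ p q ∩ lattice d = {p, q}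

/-- The counterclockwise rotation by a right angle. -/
def rot (x : Plane) : Plane := ![-x 1, x 0]

/-- The set `P` lies to the left of the segment directed from `p` to `q`: starting at a relatively
interior point of the segment and moving a little perpendicularly to the left, one is in the
interior of `P`. For a segment in the boundary of a polygon this says that the direction agrees
with the counterclockwise orientation of the boundary. -/
def LiesToLeft (P : Set Plane) (p q : Plane) : Prop :=
  ∀ x ∈ openSegment ℝ p q, ∀ᶠ ε : ℝ in 𝓝[>] 0, x + ε • rot (q - p) ∈ interior P

/-- The `d`-minimal segments that make up the boundary of `P`, with the orientation induced by the
counterclockwise orientation of `P`. The pair `(a, b)` of integer vectors stands for the oriented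
segment from `a/d` to `b/d`. -/
def boundaryEdges (d : ℕ) (P : Set Plane) : Set ((Fin 2 → ℤ) × (Fin 2 → ℤ)) :=
  {e | IsMinimalSegment d (latticePoint d e.1) (latticePoint d e.2) ∧
    segment ℝ (latticePoint d e.1) (latticePoint d e.2) ⊆ frontier P ∧
    LiesToLeft P (latticePoint d e.1) (latticePoint d e.2)}

/-- The weight of the oriented segment from `a/d` to `b/d`: the determinant of the matrix with
columns `a` and `b`, modulo `d`. -/
def edgeWeight (d : ℕ) (e : (Fin 2 → ℤ) × (Fin 2 → ℤ)) : ZMod d :=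
  ((!![e.1 0, e.2 0; e.1 1, e.2 1].det : ℤ) : ZMod d)

theorem finite_latticePoint_mem (d : ℕ) [NeZero d] {P : Set Plane} (hP : IsCompact P) :
    {a : Fin 2 → ℤ | latticePoint d a ∈ P}.Finite := by
  obtain ⟨R, hR⟩ := hP.isBounded.exists_norm_le
  have hd : (0 : ℝ) < d := by exact_mod_cast Nat.pos_of_ne_zero (NeZero.ne d)
  refine (Set.Finite.pi (t := fun _ : Fin 2 => Set.Icc (-⌈R * d⌉) ⌈R * d⌉)
    (fun _ => Set.finite_Icc _ _)).subset ?_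
  intro a ha i _
  have h1 : |(a i : ℝ) / d| ≤ R := (norm_le_pi_norm (latticePoint d a) i).trans (hR _ ha)
  rw [abs_div, abs_of_pos hd, div_le_iff₀ hd, abs_le] at h1
  have h2 : (a i : ℝ) ≤ (⌈R * d⌉ : ℤ) := h1.2.trans (Int.le_ceil _)
  have h3 : ((-⌈R * d⌉ : ℤ) : ℝ) ≤ a i := by
    push_cast
    linarith [h1.1, Int.le_ceil (R * (d : ℝ))]
  exact ⟨by exact_mod_cast h3, by exact_mod_cast h2⟩

theorem finite_boundaryEdges (d : ℕ) [NeZero d] {P : Set Plane} (hP : IsCompact P) :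
    (boundaryEdges d P).Finite := by
  refine ((finite_latticePoint_mem d hP).prod (finite_latticePoint_mem d hP)).subset ?_
  intro e he
  have h := he.2.1.trans hP.isClosed.frontier_subset
  exact ⟨h (left_mem_segment ℝ _ _), h (right_mem_segment ℝ _ _)⟩

/-- The `d`-weight of a rational polygon (whose denominator divides `d`): the multiset of the
weights of the counterclockwise oriented `d`-minimal segments of its boundary. -/
def RationalPolygon.weight (d : ℕ) [NeZero d] (P : RationalPolygon) : Multiset (ZMod d) :=
  (finite_boundaryEdges d P.isPolygon.1).toFinset.val.map (edgeWeight d)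

end Equidecomp

end

/-!
The weights of the boundary of a polygon `P` can be read off from the jumps of the indicator
function of `P`, and jumps are additive over *all* finite disjoint decompositions into rational
simplices, face to face or not.

Fix an irrational `t ∈ (0, 1)`. On every oriented `d`-minimal segment `e` choose the point `x` with
parameter `t`, and consider, for a set `X` and each of the two sides of `e`, the one-sided limit at
`x` of the indicator function of `X` minus its value at `x` (`sideJump`). Since `x` is an irrational
point of a rational line, a rational line through `x` contains `e`. Consequently:

* Near `x`, every rational open simplex contains all or nothing of either side of `e`. So the
  one-sided limits exist, and the jumps are additive (`SignDetermined.decides`, `sideJump_iUnion`).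
* A rational open simplex has nonzero jumps along finitely many minimal segments only, because these
  lie on the lines of its edges (`SignDetermined.finite_not_locallyConstant`).
* If the edges of a polygon have end points in `(1/d)ℤ × (1/d)ℤ`, then `x` is on its boundary only
  if all of `e` is. In this case the jump is `0` towards the inside and `-1` towards the outside
  (`sideJump_polygon`).

For `f : ZMod d → ℤ`, sum over all oriented minimal `e` the left jump times `f` of the weight of `e`
plus the right jump times `f` of the weight of the reversed segment (`weightedJumps`). The sum is
additive over decompositions. It is invariant under the affine unimodular group, since a
transformation of determinant `-1` negates the weights and exchanges the sides (`edgeTerm_image`).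
So it agrees for equidecomposable sets. For a polygon it is `-2 ∑ f (-w)`, the sum being over the
weights `w` of the boundary (`weightedJumps_polygon`), and indicator functions `f` give the
multiplicities of all weights. No common denominator of the simplices enters.
-/

noncomputable section

namespace Equidecomp

open Filter

/-! ### Sides of a directed line -/

/-- The planar cross product. -/
def cross (u v : Plane) : ℝ := u 0 * v 1 - u 1 * v 0

/-- The open half plane to the left of the line directed from `p` to `q`. The half plane to the
right is `leftSide q p`. -/
def leftSide (p q : Plane) : Set Plane := {y | 0 < cross (q - p) (y - p)}

theorem cross_swap (p q y : Plane) : cross (p - q) (y - q) = -cross (q - p) (y - p) := by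
  simp only [cross, Pi.sub_apply]; ring

theorem mem_leftSide_swap {p q y : Plane} :
    y ∈ leftSide q p ↔ cross (q - p) (y - p) < 0 := by
  simp only [leftSide, mem_ofPred_eq, cross_swap p q y, Left.neg_pos_iff]

theorem cross_lineMap (p q : Plane) (t : ℝ) : cross (q - p) (p + t • (q - p) - p) = 0 := by
  simp only [cross, Pi.sub_apply, Pi.add_apply, Pi.smul_apply, smul_eq_mul]; ring

theorem cross_eq_zero_of_mem_segment {p q x : Plane} (hx : x ∈ segment ℝ p q) :
    cross (q - p) (x - p) = 0 := by
  rw [segment_eq_image'] at hx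
  obtain ⟨t, -, rfl⟩ := hx
  exact cross_lineMap p q t

theorem sq_add_sq_pos {p q : Plane} (h : p ≠ q) : 0 < (q 0 - p 0) ^ 2 + (q 1 - p 1) ^ 2 := by
  by_contra hc
  apply h
  have h0 : q 0 - p 0 = 0 := by nlinarith [sq_nonneg (q 0 - p 0), sq_nonneg (q 1 - p 1)]
  have h1 : q 1 - p 1 = 0 := by nlinarith [sq_nonneg (q 0 - p 0), sq_nonneg (q 1 - p 1)]
  ext i
  fin_cases i
  · simp; linarith
  · simp; linarith

theorem tendsto_add_smul_rot {p q x : Plane} (h : p ≠ q) (hx : cross (q - p) (x - p) = 0) :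
    Tendsto (fun ε : ℝ => x + ε • rot (q - p)) (𝓝[>] 0) (𝓝[leftSide p q] x) := by
  refine tendsto_nhdsWithin_iff.2 ⟨?_, ?_⟩
  · have : Continuous fun ε : ℝ => x + ε • rot (q - p) := by fun_prop
    have h0 := this.tendsto 0
    simp only [zero_smul, add_zero] at h0
    exact h0.mono_left nhdsWithin_le_nhds
  · filter_upwards [self_mem_nhdsWithin] with ε (hε : 0 < ε)
    have h1 := mul_pos hε (sq_add_sq_pos h)
    simp only [cross, Pi.sub_apply] at hx
    simp only [leftSide, cross, rot, mem_ofPred_eq, Pi.sub_apply, Pi.add_apply, Pi.smul_apply,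
      smul_eq_mul, Matrix.cons_val_zero, Matrix.cons_val_one]
    linarith

theorem neBot_leftSide {p q x : Plane} (h : p ≠ q) (hx : cross (q - p) (x - p) = 0) :
    (𝓝[leftSide p q] x).NeBot :=
  (tendsto_add_smul_rot h hx).neBot

theorem convex_leftSide (p q : Plane) : Convex ℝ (leftSide p q) := by
  intro y hy z hz a b ha hb hab
  have key : cross (q - p) (a • y + b • z - p)
      = a * cross (q - p) (y - p) + b * cross (q - p) (z - p) := by
    obtain rfl : b = 1 - a := by linarith
    simp only [cross, Pi.sub_apply, Pi.add_apply, Pi.smul_apply, smul_eq_mul]; ring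
  simp only [leftSide, mem_ofPred_eq] at hy hz ⊢
  rw [key]
  rcases ha.eq_or_lt with rfl | ha
  · obtain rfl : b = 1 := by linarith
    simpa using hz
  · exact add_pos_of_pos_of_nonneg (mul_pos ha hy) (mul_nonneg hb hz.le)

/-! ### Sets seen along a filter -/

/-- The value `1` if the set `X` belongs to the filter `l`, and `0` otherwise. For
`l = pure x` this is the indicator function of `X` at `x`; for `l = 𝓝[leftSide p q] x` it is the
one-sided limit of the indicator function, provided that `l` decides `X`. -/
def filterValue (l : Filter Plane) (X : Set Plane) : ℤ :=
  open Classical in if ∀ᶠ y in l, y ∈ X then 1 else 0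

/-- The indicator function of `X` is eventually constant along `l`. -/
def Decides (l : Filter Plane) (X : Set Plane) : Prop :=
  (∀ᶠ y in l, y ∈ X) ∨ ∀ᶠ y in l, y ∉ X

theorem decides_pure (x : Plane) (X : Set Plane) : Decides (pure x) X := by
  simpa [Decides] using em (x ∈ X)

theorem filterValue_of_eventually {l : Filter Plane} {X : Set Plane} (h : ∀ᶠ y in l, y ∈ X) :
    filterValue l X = 1 := if_pos h

theorem filterValue_of_eventually_not {l : Filter Plane} [l.NeBot] {X : Set Plane}
    (h : ∀ᶠ y in l, y ∉ X) : filterValue l X = 0 := by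
  refine if_neg fun h' => ?_
  obtain ⟨y, hy, hy'⟩ := (h.and h').exists
  exact hy hy'

theorem filterValue_iUnion {ι : Type*} [Fintype ι] {l : Filter Plane} [l.NeBot]
    {T : ι → Set Plane} (hT : Pairwise fun i j => Disjoint (T i) (T j))
    (hl : ∀ i, Decides l (T i)) : filterValue l (⋃ i, T i) = ∑ i, filterValue l (T i) := by
  by_cases h : ∃ i, ∀ᶠ y in l, y ∈ T i
  · obtain ⟨i, hi⟩ := h
    rw [filterValue_of_eventually (hi.mono fun y hy => mem_iUnion_of_mem i hy),
      Finset.sum_eq_single i, filterValue_of_eventually hi]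
    · intro j _ hj
      exact filterValue_of_eventually_not (hi.mono fun y hy hy' => (hT hj).le_bot ⟨hy', hy⟩)
    · simp
  · rw [not_exists] at h
    have h' : ∀ i, ∀ᶠ y in l, y ∉ T i := fun i => (hl i).resolve_left (h i)
    rw [filterValue_of_eventually_not, Finset.sum_eq_zero]
    · exact fun i _ => filterValue_of_eventually_not (h' i)
    · filter_upwards [eventually_all.2 h'] with y hy
      simpa using hy

theorem filterValue_map_image {g : Plane → Plane} (hg : Function.Injective g) (l : Filter Plane)
    (X : Set Plane) : filterValue (map g l) (g '' X) = filterValue l X := by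
  have : (∀ᶠ y in map g l, y ∈ g '' X) ↔ ∀ᶠ y in l, y ∈ X := by
    simp only [eventually_map, hg.mem_set_image]
  by_cases h : ∀ᶠ y in l, y ∈ X
  · exact (if_pos (this.2 h)).trans (if_pos h).symm
  · exact (if_neg (mt this.1 h)).trans (if_neg h).symm

/-- The jump of the indicator function of `X` at the point `x` of the line directed from `p` to
`q`: its limit from the left of the line minus its value. -/
def sideJump (X : Set Plane) (p q x : Plane) : ℤ :=
  filterValue (𝓝[leftSide p q] x) X - filterValue (pure x) X

theorem sideJump_iUnion {ι : Type*} [Fintype ι] {T : ι → Set Plane} {p q x : Plane} (h : p ≠ q)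
    (hx : cross (q - p) (x - p) = 0) (hT : Pairwise fun i j => Disjoint (T i) (T j))
    (hl : ∀ i, Decides (𝓝[leftSide p q] x) (T i)) :
    sideJump (⋃ i, T i) p q x = ∑ i, sideJump (T i) p q x := by
  have := neBot_leftSide h hx
  simp only [sideJump, Finset.sum_sub_distrib]
  rw [filterValue_iUnion hT hl, filterValue_iUnion hT fun i => decides_pure x (T i)]

/-- There is no jump where the indicator function is locally constant. -/
theorem sideJump_eq_zero {X : Set Plane} {p q x : Plane} (h : p ≠ q)
    (hx : cross (q - p) (x - p) = 0) (hX : ∀ᶠ y in 𝓝 x, (y ∈ X ↔ x ∈ X)) :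
    sideJump X p q x = 0 := by
  have := neBot_leftSide h hx
  have hX' : ∀ᶠ y in 𝓝[leftSide p q] x, (y ∈ X ↔ x ∈ X) := hX.filter_mono nhdsWithin_le_nhds
  by_cases hm : x ∈ X
  · rw [sideJump, filterValue_of_eventually (hX'.mono fun y hy => hy.2 hm),
      filterValue_of_eventually (by simpa using hm), sub_self]
  · rw [sideJump, filterValue_of_eventually_not (hX'.mono fun y hy hy' => hm (hy.1 hy')),
      filterValue_of_eventually_not (by simpa using hm), sub_self]

/-! ### Rational functionals and simplices -/

/-- The affine functional on the plane with rational coefficients `c`. -/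
def ratAff (c : ℚ × ℚ × ℚ) (y : Plane) : ℝ := c.1 * y 0 + c.2.1 * y 1 + c.2.2

theorem continuous_ratAff (c : ℚ × ℚ × ℚ) : Continuous (ratAff c) := by
  unfold ratAff; fun_prop

theorem ratAff_rational (c : ℚ × ℚ × ℚ) {p : Plane} (hp : p ∈ rationalPoints) :
    ∃ r : ℚ, ratAff c p = r := by
  obtain ⟨a, rfl⟩ := hp
  exact ⟨c.1 * a 0 + c.2.1 * a 1 + c.2.2, by simp [ratAff]⟩

/-- A rational line through an irrational point of a rational line contains that line. -/
theorem ratAff_eq_zero_of_irrational {c : ℚ × ℚ × ℚ} {p q : Plane} (hp : p ∈ rationalPoints)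
    (hq : q ∈ rationalPoints) {t : ℝ} (ht : Irrational t)
    (h : ratAff c (p + t • (q - p)) = 0) : ratAff c p = 0 ∧ ratAff c q = 0 := by
  obtain ⟨r, hr⟩ := ratAff_rational c hp
  obtain ⟨s, hs⟩ := ratAff_rational c hq
  have h1 : (r : ℝ) + t * (s - r) = 0 := by
    rw [← hr, ← hs, ← h]
    simp only [ratAff, Pi.add_apply, Pi.smul_apply, Pi.sub_apply, smul_eq_mul]; ring
  have hsr : s = r := by
    by_contra hne
    have hne' : ((s - r : ℚ) : ℝ) ≠ 0 := by exact_mod_cast sub_ne_zero.2 hne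
    refine ht ⟨-r / (s - r), ?_⟩
    push_cast at hne' ⊢
    field_simp
    linarith
  subst hsr
  have : (s : ℝ) = 0 := by simpa using h1
  exact ⟨hr.trans this, hs.trans this⟩

/-- Along each side of a rational line, the sign of a rational functional is constant near an
irrational point of the line. -/
theorem exists_sign_ratAff_eq (c : ℚ × ℚ × ℚ) {p q : Plane} (hp : p ∈ rationalPoints)
    (hq : q ∈ rationalPoints) (h : p ≠ q) {t : ℝ} (ht : Irrational t) :
    ∃ s, ∀ᶠ y in 𝓝[leftSide p q] (p + t • (q - p)), SignType.sign (ratAff c y) = s := by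
  set x := p + t • (q - p)
  rcases lt_trichotomy (ratAff c x) 0 with hx | hx | hx
  · exact ⟨-1, (((continuous_ratAff c).tendsto x).eventually_lt_const hx).filter_mono
      nhdsWithin_le_nhds |>.mono fun y hy => sign_neg hy⟩
  · obtain ⟨h1, h2⟩ := ratAff_eq_zero_of_irrational hp hq ht hx
    -- The functional is a multiple `l` of the cross product with `q - p`.
    set n := (q 0 - p 0) ^ 2 + (q 1 - p 1) ^ 2 with hn
    have hn0 : 0 < n := sq_add_sq_pos h
    set l : ℝ := (c.2.1 * (q 0 - p 0) - c.1 * (q 1 - p 1)) / n with hl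
    have key : ∀ y, ratAff c y = l * cross (q - p) (y - p) := by
      intro y
      simp only [ratAff] at h1 h2
      have h3 : (c.1 : ℝ) * (q 0 - p 0) + c.2.1 * (q 1 - p 1) = 0 := by linarith
      rw [hl, div_mul_eq_mul_div, eq_div_iff hn0.ne', hn]
      simp only [ratAff, cross, Pi.sub_apply]
      linear_combination ((q 0 - p 0) ^ 2 + (q 1 - p 1) ^ 2) * h1 +
        ((y 0 - p 0) * (q 0 - p 0) + (y 1 - p 1) * (q 1 - p 1)) * h3
    refine ⟨SignType.sign l, ?_⟩
    filter_upwards [self_mem_nhdsWithin] with y hy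
    rw [key, sign_mul, sign_pos (show 0 < cross (q - p) (y - p) from hy), mul_one]
  · exact ⟨1, (((continuous_ratAff c).tendsto x).eventually_const_lt hx).filter_mono
      nhdsWithin_le_nhds |>.mono fun y hy => sign_pos hy⟩

/-- Membership in `T` depends only on the signs of finitely many rational affine functionals. -/
def SignDetermined (T : Set Plane) : Prop :=
  ∃ F : Finset (ℚ × ℚ × ℚ), ∀ y z,
    (∀ c ∈ F, SignType.sign (ratAff c y) = SignType.sign (ratAff c z)) → (y ∈ T ↔ z ∈ T)

theorem SignDetermined.decides {T : Set Plane} (hT : SignDetermined T) {p q : Plane}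
    (hp : p ∈ rationalPoints) (hq : q ∈ rationalPoints) (h : p ≠ q) {t : ℝ} (ht : Irrational t) :
    Decides (𝓝[leftSide p q] (p + t • (q - p))) T := by
  obtain ⟨F, hF⟩ := hT
  choose s hs using fun c => exists_sign_ratAff_eq c hp hq h ht
  have hall : ∀ᶠ y in 𝓝[leftSide p q] (p + t • (q - p)),
      ∀ c ∈ F, SignType.sign (ratAff c y) = s c :=
    (Filter.eventually_all_finset F).2 fun c _ => hs c
  have := neBot_leftSide h (cross_lineMap p q t)
  obtain ⟨z, hz⟩ := hall.exists
  by_cases hzT : z ∈ T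
  · exact Or.inl (hall.mono fun y hy =>
      (hF y z fun c hc => (hy c hc).trans (hz c hc).symm).2 hzT)
  · exact Or.inr (hall.mono fun y hy hyT =>
      hzT ((hF y z fun c hc => (hy c hc).trans (hz c hc).symm).1 hyT))

theorem signDetermined_pos (c : ℚ × ℚ × ℚ) : SignDetermined {y | 0 < ratAff c y} := by
  refine ⟨{c}, fun y z h => ?_⟩
  have := h c (Finset.mem_singleton_self c)
  simp only [mem_ofPred_eq]
  rw [← sign_eq_one_iff, this, sign_eq_one_iff]

theorem signDetermined_zero (c : ℚ × ℚ × ℚ) : SignDetermined {y | ratAff c y = 0} := by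
  refine ⟨{c}, fun y z h => ?_⟩
  have := h c (Finset.mem_singleton_self c)
  simp only [mem_ofPred_eq]
  rw [← sign_eq_zero_iff, this, sign_eq_zero_iff]

theorem SignDetermined.inter {S T : Set Plane} (hS : SignDetermined S) (hT : SignDetermined T) :
    SignDetermined (S ∩ T) := by
  classical
  obtain ⟨F, hF⟩ := hS
  obtain ⟨G, hG⟩ := hT
  refine ⟨F ∪ G, fun y z h => ?_⟩
  exact and_congr (hF y z fun c hc => h c (Finset.mem_union_left _ hc))
    (hG y z fun c hc => h c (Finset.mem_union_right _ hc))

theorem cross_ne_zero_of_affineIndependent {p : Fin 3 → Plane} (h : AffineIndependent ℝ p) :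
    cross (p 1 - p 0) (p 2 - p 0) ≠ 0 := by
  intro hc
  have key : ∀ a b : ℝ, a • (p 1 - p 0) + b • (p 2 - p 0) = 0 → a = 0 ∧ b = 0 := by
    intro a b hab
    have := (affineIndependent_iff.1 h) Finset.univ ![-a - b, a, b]
      (by simp [Fin.sum_univ_three]; ring)
      (by simp only [Fin.sum_univ_three, Matrix.cons_val_zero, Matrix.cons_val_one,
            Matrix.cons_val]
          rw [← hab]; module)
    exact ⟨by simpa using this 1, by simpa using this 2⟩
  have h0 := key (p 2 0 - p 0 0) (-(p 1 0 - p 0 0)) (by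
    ext i
    simp only [cross, Pi.sub_apply] at hc
    fin_cases i <;>
      simp only [Pi.add_apply, Pi.smul_apply, Pi.sub_apply, smul_eq_mul, Pi.zero_apply,
        Fin.zero_eta, Fin.mk_one] <;> linarith)
  have h1 := key (p 2 1 - p 0 1) (-(p 1 1 - p 0 1)) (by
    ext i
    simp only [cross, Pi.sub_apply] at hc
    fin_cases i <;>
      simp only [Pi.add_apply, Pi.smul_apply, Pi.sub_apply, smul_eq_mul, Pi.zero_apply,
        Fin.zero_eta, Fin.mk_one] <;> linarith)
  have : p 1 - p 0 = 0 := by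
    ext i
    fin_cases i
    exacts [neg_eq_zero.1 h0.2, neg_eq_zero.1 h1.2]
  exact absurd (key 1 0 (by simp [this])).1 one_ne_zero

theorem signDetermined_point {a : Plane} (ha : a ∈ rationalPoints) : SignDetermined {a} := by
  obtain ⟨r, rfl⟩ := ha
  convert (signDetermined_zero (1, 0, -r 0)).inter (signDetermined_zero (0, 1, -r 1)) using 1
  ext y
  simp [ratAff, funext_iff, Fin.forall_fin_two, ← sub_eq_add_neg, sub_eq_zero]

theorem signDetermined_openSegment {a b : Plane} (ha : a ∈ rationalPoints)
    (hb : b ∈ rationalPoints) (hab : a ≠ b) : SignDetermined (openSegment ℝ a b) := by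
  have hn := sq_add_sq_pos hab
  obtain ⟨r, rfl⟩ := ha
  obtain ⟨s, rfl⟩ := hb
  set u := s 0 - r 0 with hu
  set v := s 1 - r 1 with hv
  convert (signDetermined_zero (-v, u, v * r 0 - u * r 1)).inter
    ((signDetermined_pos (u, v, -(u * r 0 + v * r 1))).inter
      (signDetermined_pos (-u, -v, u * s 0 + v * s 1))) using 1
  ext y
  simp only [openSegment_eq_image', mem_image, mem_inter_iff, mem_ofPred_eq, ratAff, hu, hv]
  push_cast
  constructor
  · rintro ⟨t, ⟨h0, h1⟩, rfl⟩
    simp only [Pi.add_apply, Pi.smul_apply, Pi.sub_apply, smul_eq_mul]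
    refine ⟨by ring, ?_, ?_⟩
    · have := mul_pos h0 hn
      linarith
    · have := mul_pos (sub_pos.2 h1) hn
      linarith
  · rintro ⟨h0, h1, h2⟩
    refine ⟨(((s 0 : ℝ) - r 0) * (y 0 - r 0) + (s 1 - r 1) * (y 1 - r 1)) /
      (((s 0 : ℝ) - r 0) ^ 2 + (s 1 - r 1) ^ 2), ⟨?_, ?_⟩, ?_⟩
    · exact div_pos (by linarith) hn
    · rw [div_lt_one hn]; linarith
    · ext i
      fin_cases i
      · simp only [Pi.add_apply, Pi.smul_apply, Pi.sub_apply, smul_eq_mul, Fin.zero_eta]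
        field_simp
        linear_combination ((s 1 : ℝ) - r 1) * h0
      · simp only [Pi.add_apply, Pi.smul_apply, Pi.sub_apply, smul_eq_mul, Fin.mk_one]
        field_simp
        linear_combination (-((s 0 : ℝ) - r 0)) * h0

/-- The set of points on the same side of the line through two rational points `a`, `b` as a third
rational point `c`. -/
theorem signDetermined_halfPlane {a b c : Plane} (ha : a ∈ rationalPoints)
    (hb : b ∈ rationalPoints) (hc : c ∈ rationalPoints) :
    SignDetermined {y | 0 < cross (b - a) (c - a) * cross (b - a) (y - a)} := by
  obtain ⟨r, rfl⟩ := ha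
  obtain ⟨s, rfl⟩ := hb
  obtain ⟨t, rfl⟩ := hc
  set k := (s 0 - r 0) * (t 1 - r 1) - (s 1 - r 1) * (t 0 - r 0) with hk
  convert signDetermined_pos (-k * (s 1 - r 1), k * (s 0 - r 0),
    k * (-(s 0 - r 0) * r 1 + (s 1 - r 1) * r 0)) using 1
  ext y
  simp only [mem_ofPred_eq, ratAff, cross, Pi.sub_apply, hk]
  push_cast
  ring_nf

theorem mem_openSimplex_three {p : Fin 3 → Plane} {y : Plane} :
    y ∈ openSimplex p ↔ ∃ w : Fin 3 → ℝ, (∀ i, 0 < w i) ∧ w 0 + w 1 + w 2 = 1 ∧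
      w 0 • p 0 + w 1 • p 1 + w 2 • p 2 = y :=
  exists_congr fun w => and_congr_right fun _ => and_congr
    (Eq.congr (Fin.sum_univ_three w) rfl)
    (Eq.congr (Fin.sum_univ_three fun i => w i • p i) rfl)

theorem openSimplex_three (p : Fin 3 → Plane) (h : cross (p 1 - p 0) (p 2 - p 0) ≠ 0) :
    openSimplex p = {y | 0 < cross (p 1 - p 0) (p 2 - p 0) * cross (p 1 - p 0) (y - p 0)} ∩
      ({y | 0 < cross (p 2 - p 1) (p 0 - p 1) * cross (p 2 - p 1) (y - p 1)} ∩
        {y | 0 < cross (p 0 - p 2) (p 1 - p 2) * cross (p 0 - p 2) (y - p 2)}) := by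
  set D := cross (p 1 - p 0) (p 2 - p 0) with hD
  have h1 : cross (p 2 - p 1) (p 0 - p 1) = D := by
    simp only [hD, cross, Pi.sub_apply]; ring
  have h2 : cross (p 0 - p 2) (p 1 - p 2) = D := by
    simp only [hD, cross, Pi.sub_apply]; ring
  have hDD : 0 < D * D := mul_self_pos.2 h
  rw [h1, h2]
  ext y
  simp only [mem_openSimplex_three, mem_ofPred_eq, mem_inter_iff]
  constructor
  · rintro ⟨w, hw, hs, rfl⟩
    have e0 : w 0 = 1 - w 1 - w 2 := by linarith
    have k2 : cross (p 1 - p 0) (w 0 • p 0 + w 1 • p 1 + w 2 • p 2 - p 0) = w 2 * D := by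
      simp only [hD, cross, Pi.sub_apply, Pi.add_apply, Pi.smul_apply,
        smul_eq_mul, e0]; ring
    have k0 : cross (p 2 - p 1) (w 0 • p 0 + w 1 • p 1 + w 2 • p 2 - p 1) = w 0 * D := by
      simp only [hD, cross, Pi.sub_apply, Pi.add_apply, Pi.smul_apply,
        smul_eq_mul, e0]; ring
    have k1 : cross (p 0 - p 2) (w 0 • p 0 + w 1 • p 1 + w 2 • p 2 - p 2) = w 1 * D := by
      simp only [hD, cross, Pi.sub_apply, Pi.add_apply, Pi.smul_apply,
        smul_eq_mul, e0]; ring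
    rw [k0, k1, k2]
    refine ⟨?_, ?_, ?_⟩ <;> rw [mul_left_comm] <;> exact mul_pos (hw _) hDD
  · rintro ⟨l2, l0, l1⟩
    refine ⟨![cross (p 2 - p 1) (y - p 1) / D, cross (p 0 - p 2) (y - p 2) / D,
      cross (p 1 - p 0) (y - p 0) / D], ?_, ?_, ?_⟩
    · have : ∀ z, 0 < D * z → 0 < z / D := fun z hz => by
        have := div_pos hz hDD
        rwa [mul_div_mul_left _ _ h] at this
      intro i
      fin_cases i
      exacts [this _ l0, this _ l1, this _ l2]
    · simp only [Matrix.cons_val_zero, Matrix.cons_val_one, Matrix.cons_val]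
      rw [← add_div, ← add_div, div_eq_one_iff_eq h]
      simp only [hD, cross, Pi.sub_apply]; ring
    · ext i
      simp only [Matrix.cons_val_zero, Matrix.cons_val_one, Matrix.cons_val,
        Pi.add_apply, Pi.smul_apply, smul_eq_mul]
      field_simp
      fin_cases i <;> simp only [hD, cross, Pi.sub_apply, Fin.zero_eta, Fin.mk_one] <;> ring

theorem openSimplex_one (p : Fin 1 → Plane) : openSimplex p = {p 0} := by
  ext y
  constructor
  · rintro ⟨w, -, h1, rfl⟩
    have h1' : w 0 = 1 := (Fin.sum_univ_one w).symm.trans h1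
    refine (Fin.sum_univ_one fun i => w i • p i).trans ?_
    simp only [h1', one_smul]
  · rintro rfl
    exact ⟨fun _ => 1, fun _ => one_pos, Fin.sum_univ_one _,
      (Fin.sum_univ_one _).trans (one_smul _ _)⟩

theorem openSimplex_two (p : Fin 2 → Plane) : openSimplex p = openSegment ℝ (p 0) (p 1) := by
  ext y
  constructor
  · rintro ⟨w, h, h1, h2⟩
    exact ⟨w 0, w 1, h 0, h 1, (Fin.sum_univ_two w).symm.trans h1,
      (Fin.sum_univ_two fun i => w i • p i).symm.trans h2⟩
  · rintro ⟨a, b, ha, hb, h1, h2⟩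
    exact ⟨![a, b], Fin.forall_fin_two.2 ⟨ha, hb⟩, (Fin.sum_univ_two _).trans h1,
      (Fin.sum_univ_two _).trans h2⟩

theorem IsRationalOpenSimplex.signDetermined {T : Set Plane} (hT : IsRationalOpenSimplex T) :
    SignDetermined T := by
  obtain ⟨k, p, hp, hi, rfl⟩ := hT
  have hk : k ≤ 2 := by
    have h1 := hi.card_le_finrank_succ
    have h2 := Submodule.finrank_le (vectorSpan ℝ (range p))
    simp only [Fintype.card_fin, Module.finrank_fin_fun] at h1 h2
    omega
  interval_cases k
  · rw [openSimplex_one]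
    exact signDetermined_point (hp 0)
  · rw [openSimplex_two]
    exact signDetermined_openSegment (hp 0) (hp 1) fun h => by simpa using hi.injective h
  · rw [openSimplex_three p (cross_ne_zero_of_affineIndependent hi)]
    exact (signDetermined_halfPlane (hp 0) (hp 1) (hp 2)).inter
      ((signDetermined_halfPlane (hp 1) (hp 2) (hp 0)).inter
        (signDetermined_halfPlane (hp 2) (hp 0) (hp 1)))

/-! ### Jumps occur along finitely many minimal segments -/

theorem latticePoint_mem_rationalPoints (d : ℕ) (a : Fin 2 → ℤ) :
    latticePoint d a ∈ rationalPoints :=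
  ⟨fun i => a i / d, by ext i; simp [latticePoint]⟩

theorem IsMinimalSegment.notMem_lattice {d : ℕ} {p q : Plane} (h : IsMinimalSegment d p q)
    {x : Plane} (hx : x ∈ openSegment ℝ p q) : x ∉ lattice d := by
  intro hl
  have : x ∈ ({p, q} : Set Plane) := h.2 ▸ ⟨openSegment_subset_segment ℝ p q hx, hl⟩
  rcases this with rfl | rfl
  · exact h.1 ((left_mem_openSegment_iff).1 hx)
  · exact h.1 ((right_mem_openSegment_iff).1 hx)

theorem IsMinimalSegment.symm {d : ℕ} {p q : Plane} (h : IsMinimalSegment d p q) :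
    IsMinimalSegment d q p :=
  ⟨h.1.symm, by rw [segment_symm, h.2, pair_comm]⟩

/-- A rational line has a lattice direction vector `n`, which bounds the length of the minimal
segments on the line. -/
theorem exists_bound_of_ratAff_eq_zero (d : ℕ) [NeZero d] (c : ℚ × ℚ × ℚ)
    (hc : c.1 ≠ 0 ∨ c.2.1 ≠ 0) : ∃ K : ℝ, ∀ a b : Fin 2 → ℤ,
      IsMinimalSegment d (latticePoint d a) (latticePoint d b) → ratAff c (latticePoint d a) = 0 →
      ratAff c (latticePoint d b) = 0 → ‖latticePoint d b - latticePoint d a‖ ≤ K := by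
  have hd : (d : ℝ) ≠ 0 := NeZero.ne _
  -- Clearing denominators in the direction `(-c.2.1, c.1)` gives `n`.
  set n : Fin 2 → ℤ := ![-(c.2.1.num * c.1.den), c.1.num * c.2.1.den] with hn
  have hn0 : (n 0 : ℝ) = -c.2.1 * (c.1.den * c.2.1.den) := by
    have : (c.2.1 : ℝ) * c.2.1.den = c.2.1.num := by exact_mod_cast c.2.1.mul_den_eq_num
    simp only [hn, Matrix.cons_val_zero]
    push_cast
    rw [← this]; ring
  have hn1 : (n 1 : ℝ) = c.1 * (c.1.den * c.2.1.den) := by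
    have : (c.1 : ℝ) * c.1.den = c.1.num := by exact_mod_cast c.1.mul_den_eq_num
    simp only [hn, Matrix.cons_val_one]
    push_cast
    rw [← this]; ring
  have hD : ((c.1.den : ℝ) * c.2.1.den) ≠ 0 := by
    have := c.1.den_nz
    have := c.2.1.den_nz
    positivity
  set D : ℝ := (c.1.den : ℝ) * c.2.1.den
  have hpos : 0 < (n 0 : ℝ) ^ 2 + (n 1 : ℝ) ^ 2 := by
    rw [hn0, hn1]
    rcases hc with hc | hc
    · have h1 : (c.1 : ℝ) ≠ 0 := by exact_mod_cast hc
      exact add_pos_of_nonneg_of_pos (sq_nonneg _) (sq_pos_of_ne_zero (mul_ne_zero h1 hD))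
    · have h1 : (c.2.1 : ℝ) ≠ 0 := by exact_mod_cast hc
      exact add_pos_of_pos_of_nonneg (sq_pos_of_ne_zero (mul_ne_zero (neg_ne_zero.2 h1) hD))
        (sq_nonneg _)
  refine ⟨‖latticePoint d n‖, fun a b hab ha hb => ?_⟩
  simp only [ratAff, latticePoint] at ha hb
  have horth : (n 1 : ℝ) * ((b 0 : ℝ) / d - a 0 / d) = n 0 * ((b 1 : ℝ) / d - a 1 / d) := by
    rw [hn0, hn1]
    linear_combination D * (hb - ha)
  obtain ⟨l, hl⟩ : ∃ l : ℝ, latticePoint d b - latticePoint d a = l • latticePoint d n := by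
    refine ⟨((b 0 - a 0) * n 0 + (b 1 - a 1) * n 1) / ((n 0 : ℝ) ^ 2 + (n 1 : ℝ) ^ 2), ?_⟩
    field_simp at horth
    ext i
    fin_cases i
    · simp only [latticePoint, Pi.sub_apply, Pi.smul_apply, smul_eq_mul, Fin.zero_eta]
      field_simp
      linear_combination (n 1 : ℝ) * horth
    · simp only [latticePoint, Pi.sub_apply, Pi.smul_apply, smul_eq_mul, Fin.mk_one]
      field_simp
      linear_combination (-n 0 : ℝ) * horth
  rw [hl, norm_smul]
  suffices |l| ≤ 1 from mul_le_of_le_one_left (norm_nonneg _) this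
  by_contra hlt
  rw [not_le, lt_abs] at hlt
  -- Otherwise `a + n` or `a - n` is a lattice point inside the segment.
  rcases hlt with hlt | hlt
  · refine hab.notMem_lattice (x := latticePoint d (a + n)) ?_ ⟨_, rfl⟩
    rw [openSegment_eq_image']
    refine ⟨l⁻¹, ⟨by positivity, inv_lt_one_of_one_lt₀ hlt⟩, ?_⟩
    simp only
    rw [hl, smul_smul, inv_mul_cancel₀ (by positivity), one_smul]
    ext i
    simp [latticePoint, add_div]
  · refine hab.notMem_lattice (x := latticePoint d (a - n)) ?_ ⟨_, rfl⟩
    rw [openSegment_eq_image']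
    refine ⟨(-l)⁻¹, ⟨by positivity, inv_lt_one_of_one_lt₀ hlt⟩, ?_⟩
    simp only
    have hl0 : l ≠ 0 := by rintro rfl; norm_num at hlt
    rw [hl, smul_smul, inv_neg, neg_mul, inv_mul_cancel₀ hl0, neg_smul, one_smul]
    ext i
    simp only [latticePoint, Pi.add_apply, Pi.neg_apply, Pi.sub_apply, Int.cast_sub]
    ring

/-- The point of the segment from `e.1 / d` to `e.2 / d` that divides it in the ratio
`t : 1 - t`. -/
def edgePoint (d : ℕ) (t : ℝ) (e : (Fin 2 → ℤ) × (Fin 2 → ℤ)) : Plane :=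
  latticePoint d e.1 + t • (latticePoint d e.2 - latticePoint d e.1)

/-- If the indicator function of a bounded sign determined set is not locally constant at the
irrational point with parameter `t` of a minimal segment, then the segment lies on one of finitely
many rational lines, and hence is one of finitely many. -/
theorem SignDetermined.finite_not_locallyConstant (d : ℕ) [NeZero d] {T : Set Plane}
    (hT : SignDetermined T) (hb : Bornology.IsBounded T) {t : ℝ} (ht : Irrational t)
    (ht01 : t ∈ Ioo 0 1) :
    {e : (Fin 2 → ℤ) × (Fin 2 → ℤ) |
      IsMinimalSegment d (latticePoint d e.1) (latticePoint d e.2) ∧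
      ¬∀ᶠ y in 𝓝 (edgePoint d t e), (y ∈ T ↔ edgePoint d t e ∈ T)}.Finite := by
  obtain ⟨F, hF⟩ := hT
  obtain ⟨R, hR⟩ := hb.closure.exists_norm_le
  have hfin : ∀ c ∈ F, {e : (Fin 2 → ℤ) × (Fin 2 → ℤ) | (c.1 ≠ 0 ∨ c.2.1 ≠ 0) ∧
      IsMinimalSegment d (latticePoint d e.1) (latticePoint d e.2) ∧
      ratAff c (latticePoint d e.1) = 0 ∧ ratAff c (latticePoint d e.2) = 0 ∧
      edgePoint d t e ∈ closure T}.Finite := by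
    intro c _
    by_cases hc : c.1 ≠ 0 ∨ c.2.1 ≠ 0
    · obtain ⟨K, hK⟩ := exists_bound_of_ratAff_eq_zero d c hc
      have hball := finite_latticePoint_mem d (isCompact_closedBall (0 : Plane) (R + K + K))
      refine (hball.prod hball).subset ?_
      rintro ⟨a, b⟩ ⟨-, hmin, h1, h2, hcl⟩
      have hk := hK a b hmin h1 h2
      have hx := hR _ hcl
      simp only [edgePoint] at hx
      have hK0 := (norm_nonneg _).trans hk
      have ha : ‖latticePoint d a‖ ≤ R + K := by
        calc ‖latticePoint d a‖ = ‖(latticePoint d a + t • (latticePoint d b - latticePoint d a))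
              - t • (latticePoint d b - latticePoint d a)‖ := by rw [add_sub_cancel_right]
          _ ≤ R + ‖t • (latticePoint d b - latticePoint d a)‖ :=
            (norm_sub_le _ _).trans (by gcongr)
          _ ≤ R + K := by
            rw [norm_smul, Real.norm_of_nonneg ht01.1.le]
            nlinarith [ht01.1, ht01.2, norm_nonneg (latticePoint d b - latticePoint d a)]
      have hb' : ‖latticePoint d b‖ ≤ R + K + K := by
        calc ‖latticePoint d b‖ = ‖latticePoint d a + (latticePoint d b - latticePoint d a)‖ := by
              rw [add_sub_cancel]
          _ ≤ R + K + K := (norm_add_le _ _).trans (add_le_add ha hk)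
      exact ⟨by simpa using ha.trans (by linarith), by simpa using hb'⟩
    · convert Set.finite_empty
      ext e
      simp [hc]
  refine (F.finite_toSet.biUnion hfin).subset ?_
  rintro e ⟨hmin, hnc⟩
  have hcl : edgePoint d t e ∈ closure T := by
    by_contra hcl
    refine hnc ?_
    filter_upwards [isClosed_closure.isOpen_compl.mem_nhds hcl] with y hy
    exact iff_of_false (fun h => hy (subset_closure h)) fun h => hcl (subset_closure h)
  by_contra hno
  refine hnc ?_
  have hsign : ∀ᶠ y in 𝓝 (edgePoint d t e), ∀ c ∈ F,
      SignType.sign (ratAff c y) = SignType.sign (ratAff c (edgePoint d t e)) := by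
    refine (Filter.eventually_all_finset F).2 fun c hcF => ?_
    rcases lt_trichotomy (ratAff c (edgePoint d t e)) 0 with hx | hx | hx
    · filter_upwards [((continuous_ratAff c).tendsto _).eventually_lt_const hx] with y hy
      rw [sign_neg hy, sign_neg hx]
    · have hz := ratAff_eq_zero_of_irrational (latticePoint_mem_rationalPoints d e.1)
        (latticePoint_mem_rationalPoints d e.2) ht hx
      have hc : ¬(c.1 ≠ 0 ∨ c.2.1 ≠ 0) := fun hc =>
        hno (mem_biUnion hcF ⟨hc, hmin, hz.1, hz.2, hcl⟩)
      push Not at hc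
      exact Eventually.of_forall fun y => by simp [ratAff, hc.1, hc.2]
    · filter_upwards [((continuous_ratAff c).tendsto _).eventually_const_lt hx] with y hy
      rw [sign_pos hy, sign_pos hx]
  exact hsign.mono fun y hy => hF y _ hy

/-! ### The action of the affine unimodular group -/

theorem gMap_apply_zero (U : GL (Fin 2) ℤ) (v : Fin 2 → ℤ) (x : Plane) :
    gMap U v x 0 = U.val 0 0 * x 0 + U.val 0 1 * x 1 + v 0 := by
  simp [gMap]

theorem gMap_apply_one (U : GL (Fin 2) ℤ) (v : Fin 2 → ℤ) (x : Plane) :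
    gMap U v x 1 = U.val 1 0 * x 0 + U.val 1 1 * x 1 + v 1 := by
  simp [gMap]

/-- The transformation `gMap U v` as an affine map. -/
def gAffine (U : GL (Fin 2) ℤ) (v : Fin 2 → ℤ) : Plane →ᵃ[ℝ] Plane :=
  (Matrix.toLin' (U.val.map fun z : ℤ => (z : ℝ))).toAffineMap +
    AffineMap.const ℝ Plane (fun i => (v i : ℝ))

theorem coe_gAffine (U : GL (Fin 2) ℤ) (v : Fin 2 → ℤ) : ⇑(gAffine U v) = gMap U v := by
  ext x i
  simp [gAffine, gMap]

theorem gMap_add_smul_sub (U : GL (Fin 2) ℤ) (v : Fin 2 → ℤ) (p q : Plane) (t : ℝ) :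
    gMap U v (p + t • (q - p)) = gMap U v p + t • (gMap U v q - gMap U v p) := by
  ext i
  fin_cases i <;>
    simp only [Fin.zero_eta, Fin.mk_one, gMap_apply_zero, gMap_apply_one, Pi.add_apply,
      Pi.smul_apply, Pi.sub_apply, smul_eq_mul] <;> ring

theorem cross_gMap (U : GL (Fin 2) ℤ) (v : Fin 2 → ℤ) (p q y : Plane) :
    cross (gMap U v q - gMap U v p) (gMap U v y - gMap U v p) =
      (U.val.det : ℝ) * cross (q - p) (y - p) := by
  simp only [cross, Pi.sub_apply, gMap_apply_zero, gMap_apply_one, Matrix.det_fin_two]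
  push_cast
  ring

theorem det_eq_one_or_neg_one (U : GL (Fin 2) ℤ) : U.val.det = 1 ∨ U.val.det = -1 :=
  Int.isUnit_iff.1 ((Matrix.isUnit_iff_isUnit_det _).1 U.isUnit)

theorem gMap_inv_gMap (U : GL (Fin 2) ℤ) (v : Fin 2 → ℤ) (x : Plane) :
    gMap U⁻¹ (-((U⁻¹).val *ᵥ v)) (gMap U v x) = x := by
  have h : (U⁻¹).val * U.val = 1 := U.inv_mul
  have h1 : ((U⁻¹).val.map fun z : ℤ => (z : ℝ)) * (U.val.map fun z : ℤ => (z : ℝ)) = 1 := by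
    have := congrArg (fun M => Matrix.map M (Int.castRingHom ℝ)) h
    simp only [Matrix.map_mul] at this
    simpa using this
  have h2 : (fun i => ((-((U⁻¹).val *ᵥ v)) i : ℝ)) =
      -(((U⁻¹).val.map fun z : ℤ => (z : ℝ)) *ᵥ fun i => (v i : ℝ)) := by
    ext i
    simp only [Pi.neg_apply, Matrix.mulVec, dotProduct, Matrix.map_apply]
    push_cast
    rfl
  simp only [gMap]
  rw [h2, Matrix.mulVec_add, Matrix.mulVec_mulVec, h1, Matrix.one_mulVec, add_neg_cancel_right]

theorem gMap_gMap_inv (U : GL (Fin 2) ℤ) (v : Fin 2 → ℤ) (x : Plane) :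
    gMap U v (gMap U⁻¹ (-((U⁻¹).val *ᵥ v)) x) = x := by
  have := gMap_inv_gMap U⁻¹ (-((U⁻¹).val *ᵥ v)) x
  have hv : -(((U⁻¹)⁻¹).val *ᵥ -((U⁻¹).val *ᵥ v)) = v := by
    have h : U.val * (U⁻¹).val = 1 := U.mul_inv
    rw [inv_inv, Matrix.mulVec_neg, neg_neg, Matrix.mulVec_mulVec, h, Matrix.one_mulVec]
  rwa [hv, inv_inv] at this

theorem continuous_gMap (U : GL (Fin 2) ℤ) (v : Fin 2 → ℤ) : Continuous (gMap U v) :=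
  coe_gAffine U v ▸ (gAffine U v).continuous_of_finiteDimensional

/-- The transformation `gMap U v` as a homeomorphism. -/
def gHomeo (U : GL (Fin 2) ℤ) (v : Fin 2 → ℤ) : Plane ≃ₜ Plane where
  toFun := gMap U v
  invFun := gMap U⁻¹ (-((U⁻¹).val *ᵥ v))
  left_inv := gMap_inv_gMap U v
  right_inv := gMap_gMap_inv U v
  continuous_toFun := continuous_gMap U v
  continuous_invFun := continuous_gMap _ _

theorem gMap_injective (U : GL (Fin 2) ℤ) (v : Fin 2 → ℤ) : Function.Injective (gMap U v) :=
  (gHomeo U v).injective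

theorem gMap_surjective (U : GL (Fin 2) ℤ) (v : Fin 2 → ℤ) : Function.Surjective (gMap U v) :=
  (gHomeo U v).surjective

theorem image_leftSide_of_det_eq_one {U : GL (Fin 2) ℤ} (v : Fin 2 → ℤ) (hU : U.val.det = 1)
    (p q : Plane) : gMap U v '' leftSide p q = leftSide (gMap U v p) (gMap U v q) := by
  ext y
  obtain ⟨y, rfl⟩ := gMap_surjective U v y
  rw [(gMap_injective U v).mem_set_image]
  simp [leftSide, cross_gMap, hU]

theorem image_leftSide_of_det_eq_neg_one {U : GL (Fin 2) ℤ} (v : Fin 2 → ℤ)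
    (hU : U.val.det = -1) (p q : Plane) :
    gMap U v '' leftSide p q = leftSide (gMap U v q) (gMap U v p) := by
  ext y
  obtain ⟨y, rfl⟩ := gMap_surjective U v y
  rw [(gMap_injective U v).mem_set_image, mem_leftSide_swap]
  simp [leftSide, cross_gMap, hU]

theorem filterValue_nhdsWithin_image (U : GL (Fin 2) ℤ) (v : Fin 2 → ℤ) (S X : Set Plane)
    (x : Plane) :
    filterValue (𝓝[gMap U v '' S] (gMap U v x)) (gMap U v '' X) = filterValue (𝓝[S] x) X := by
  have := (gHomeo U v).isEmbedding.map_nhdsWithin_eq S x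
  rw [← filterValue_map_image (gMap_injective U v) (𝓝[S] x) X]
  exact congrArg (fun l => filterValue l (gMap U v '' X)) this.symm

theorem filterValue_pure_image (U : GL (Fin 2) ℤ) (v : Fin 2 → ℤ) (X : Set Plane) (x : Plane) :
    filterValue (pure (gMap U v x)) (gMap U v '' X) = filterValue (pure x) X := by
  rw [← filterValue_map_image (gMap_injective U v) (pure x) X, map_pure]

theorem sideJump_image_of_det_eq_one {U : GL (Fin 2) ℤ} (v : Fin 2 → ℤ) (hU : U.val.det = 1)
    (X : Set Plane) (p q x : Plane) :
    sideJump (gMap U v '' X) (gMap U v p) (gMap U v q) (gMap U v x) = sideJump X p q x := by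
  rw [sideJump, ← image_leftSide_of_det_eq_one v hU, filterValue_nhdsWithin_image,
    filterValue_pure_image, sideJump]

theorem sideJump_image_of_det_eq_neg_one {U : GL (Fin 2) ℤ} (v : Fin 2 → ℤ)
    (hU : U.val.det = -1) (X : Set Plane) (p q x : Plane) :
    sideJump (gMap U v '' X) (gMap U v p) (gMap U v q) (gMap U v x) = sideJump X q p x := by
  rw [sideJump, ← image_leftSide_of_det_eq_neg_one v hU, filterValue_nhdsWithin_image,
    filterValue_pure_image, sideJump]

/-- The action of `gMap U v` on the lattice `(1/d)ℤ × (1/d)ℤ`, in terms of numerators. -/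
def latticeEquiv (d : ℕ) (U : GL (Fin 2) ℤ) (v : Fin 2 → ℤ) : (Fin 2 → ℤ) ≃ (Fin 2 → ℤ) where
  toFun a := U.val *ᵥ a + (d : ℤ) • v
  invFun a := (U⁻¹).val *ᵥ (a - (d : ℤ) • v)
  left_inv a := by
    have h : (U⁻¹).val * U.val = 1 := U.inv_mul
    simp only
    rw [add_sub_cancel_right, Matrix.mulVec_mulVec, h, Matrix.one_mulVec]
  right_inv a := by
    have h : U.val * (U⁻¹).val = 1 := U.mul_inv
    simp only
    rw [Matrix.mulVec_mulVec, h, Matrix.one_mulVec, sub_add_cancel]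

theorem latticeEquiv_apply (d : ℕ) (U : GL (Fin 2) ℤ) (v a : Fin 2 → ℤ) (i : Fin 2) :
    latticeEquiv d U v a i = U.val i 0 * a 0 + U.val i 1 * a 1 + d * v i := by
  change (U.val *ᵥ a) i + (d : ℤ) * v i = _
  rw [Matrix.mulVec, dotProduct, Fin.sum_univ_two]

theorem latticePoint_latticeEquiv (d : ℕ) [NeZero d] (U : GL (Fin 2) ℤ) (v a : Fin 2 → ℤ) :
    latticePoint d (latticeEquiv d U v a) = gMap U v (latticePoint d a) := by
  have hd : (d : ℝ) ≠ 0 := NeZero.ne _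
  ext i
  fin_cases i <;>
  · simp only [Fin.zero_eta, Fin.mk_one, gMap_apply_zero, gMap_apply_one]
    simp only [latticePoint, latticeEquiv_apply]
    push_cast
    field_simp

theorem image_lattice (d : ℕ) [NeZero d] (U : GL (Fin 2) ℤ) (v : Fin 2 → ℤ) :
    gMap U v '' lattice d = lattice d := by
  rw [lattice, ← range_comp, ← (latticeEquiv d U v).surjective.range_comp (latticePoint d)]
  congr 1
  ext1 a
  exact (latticePoint_latticeEquiv d U v a).symm

theorem isMinimalSegment_gMap (d : ℕ) [NeZero d] (U : GL (Fin 2) ℤ) (v : Fin 2 → ℤ)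
    (p q : Plane) :
    IsMinimalSegment d (gMap U v p) (gMap U v q) ↔ IsMinimalSegment d p q := by
  have hi := gMap_injective U v
  refine and_congr hi.ne_iff ?_
  have hs : segment ℝ (gMap U v p) (gMap U v q) = gMap U v '' segment ℝ p q := by
    rw [← coe_gAffine, image_segment]
  conv_lhs => rw [hs, ← image_lattice d U v, ← image_inter hi, ← image_pair]
  exact hi.image_injective.eq_iff

/-- The action of `gMap U v` on pairs of numerators of lattice points. -/
def edgeEquiv (d : ℕ) (U : GL (Fin 2) ℤ) (v : Fin 2 → ℤ) :
    (Fin 2 → ℤ) × (Fin 2 → ℤ) ≃ (Fin 2 → ℤ) × (Fin 2 → ℤ) :=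
  (latticeEquiv d U v).prodCongr (latticeEquiv d U v)

theorem edgePoint_edgeEquiv (d : ℕ) [NeZero d] (t : ℝ) (U : GL (Fin 2) ℤ) (v : Fin 2 → ℤ)
    (e : (Fin 2 → ℤ) × (Fin 2 → ℤ)) :
    edgePoint d t (edgeEquiv d U v e) = gMap U v (edgePoint d t e) := by
  simp only [edgePoint, edgeEquiv, Equiv.prodCongr_apply, Prod.map_fst, Prod.map_snd,
    latticePoint_latticeEquiv, gMap_add_smul_sub]

theorem edgeWeight_eq (d : ℕ) (e : (Fin 2 → ℤ) × (Fin 2 → ℤ)) :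
    edgeWeight d e = ((e.1 0 * e.2 1 - e.2 0 * e.1 1 : ℤ) : ZMod d) := by
  rw [edgeWeight, Matrix.det_fin_two_of]

theorem edgeWeight_edgeEquiv (d : ℕ) (U : GL (Fin 2) ℤ) (v : Fin 2 → ℤ)
    (e : (Fin 2 → ℤ) × (Fin 2 → ℤ)) :
    edgeWeight d (edgeEquiv d U v e) = (U.val.det : ZMod d) * edgeWeight d e := by
  rw [edgeWeight_eq, edgeWeight_eq, Matrix.det_fin_two]
  simp only [edgeEquiv, Equiv.prodCongr_apply, Prod.map_fst, Prod.map_snd, latticeEquiv_apply]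
  push_cast
  simp only [ZMod.natCast_self]
  ring

theorem edgeWeight_swap (d : ℕ) (e : (Fin 2 → ℤ) × (Fin 2 → ℤ)) :
    edgeWeight d e.swap = -edgeWeight d e := by
  simp only [edgeWeight_eq, Prod.fst_swap, Prod.snd_swap]
  push_cast
  ring

theorem gMap_mem_rationalPoints (U : GL (Fin 2) ℤ) (v : Fin 2 → ℤ) {p : Plane}
    (hp : p ∈ rationalPoints) : gMap U v p ∈ rationalPoints := by
  obtain ⟨a, rfl⟩ := hp
  refine ⟨![U.val 0 0 * a 0 + U.val 0 1 * a 1 + v 0, U.val 1 0 * a 0 + U.val 1 1 * a 1 + v 1], ?_⟩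
  ext i
  fin_cases i
  · simp [gMap_apply_zero]
  · simp [gMap_apply_one]

theorem image_openSimplex (f : Plane →ᵃ[ℝ] Plane) {k : ℕ} (p : Fin (k + 1) → Plane) :
    f '' openSimplex p = openSimplex (f ∘ p) := by
  have key : ∀ w : Fin (k + 1) → ℝ, ∑ i, w i = 1 →
      ∑ i, w i • (f ∘ p) i = f (∑ i, w i • p i) := by
    intro w hw
    have := Finset.univ.map_affineCombination p w hw f
    rw [Finset.affineCombination_eq_linear_combination _ _ _ hw,
      Finset.affineCombination_eq_linear_combination _ _ _ hw] at this
    exact this.symm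
  ext y
  constructor
  · rintro ⟨_, ⟨w, h0, h1, rfl⟩, rfl⟩
    exact ⟨w, h0, h1, key w h1⟩
  · rintro ⟨w, h0, h1, rfl⟩
    exact ⟨_, ⟨w, h0, h1, rfl⟩, (key w h1).symm⟩

theorem IsRationalOpenSimplex.gMap {T : Set Plane} (hT : IsRationalOpenSimplex T)
    (U : GL (Fin 2) ℤ) (v : Fin 2 → ℤ) : IsRationalOpenSimplex (gMap U v '' T) := by
  obtain ⟨k, p, hp, hi, rfl⟩ := hT
  refine ⟨k, Equidecomp.gMap U v ∘ p, fun i => gMap_mem_rationalPoints U v (hp i), ?_, ?_⟩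
  · rw [← coe_gAffine]
    exact hi.map' _ (coe_gAffine U v ▸ gMap_injective U v)
  · rw [← coe_gAffine, image_openSimplex]

/-! ### The boundary of a polygon -/

theorem lattice_subset_rationalPoints (d : ℕ) : lattice d ⊆ rationalPoints := by
  rintro _ ⟨a, rfl⟩
  exact latticePoint_mem_rationalPoints d a

theorem isPolygonOver_lattice_of_denominator_dvd {d : ℕ} [NeZero d] (P : RationalPolygon)
    (hP : P.denominator ∣ d) : IsPolygonOver (lattice d) P.carrier := by
  have hne : {N : ℕ | 0 < N ∧ IsIntegralPolygon ((N : ℝ) • P.carrier)}.Nonempty := by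
    by_contra h
    rw [not_nonempty_iff_eq_empty] at h
    rw [RationalPolygon.denominator, h, Nat.sInf_empty, zero_dvd_iff] at hP
    exact NeZero.ne d hP
  obtain ⟨hN, -, -, S, hS1, hS2, hS3⟩ := Nat.sInf_mem hne
  change 0 < P.denominator at hN
  change ∀ e ∈ S, e.1 ∈ lattice 1 ∧ e.2 ∈ lattice 1 ∧ e.1 ≠ e.2 at hS1
  change frontier ((P.denominator : ℝ) • P.carrier) = _ at hS3
  generalize P.denominator = N at *
  obtain ⟨m, rfl⟩ := hP
  have hN0 : (N : ℝ) ≠ 0 := by exact_mod_cast hN.ne'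
  have hm0 : (m : ℝ) ≠ 0 := by
    rintro h
    have : m = 0 := by exact_mod_cast h
    exact NeZero.ne (N * m) (by simp [this])
  have hlat : ∀ x ∈ lattice 1, (N : ℝ)⁻¹ • x ∈ lattice (N * m) := by
    rintro _ ⟨a, rfl⟩
    refine ⟨(m : ℤ) • a, ?_⟩
    ext i
    simp only [latticePoint, Pi.smul_apply, smul_eq_mul]
    push_cast
    field_simp
  have hseg : ∀ x y : Plane, segment ℝ ((N : ℝ)⁻¹ • x) ((N : ℝ)⁻¹ • y) =
      (N : ℝ)⁻¹ • segment ℝ x y := fun x y =>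
    (image_segment ℝ (LinearMap.lsmul ℝ Plane (N : ℝ)⁻¹).toAffineMap x y).symm
  have hinj : Function.Injective fun x : Plane => (N : ℝ)⁻¹ • x :=
    smul_right_injective _ (inv_ne_zero hN0)
  classical
  refine ⟨P.isPolygon.1, P.isPolygon.2.1,
    S.image fun e => ((N : ℝ)⁻¹ • e.1, (N : ℝ)⁻¹ • e.2), ?_, ?_, ?_⟩
  · intro e' he'
    obtain ⟨e, he, rfl⟩ := Finset.mem_image.1 he'
    obtain ⟨h1, h2, h3⟩ := hS1 e he
    exact ⟨hlat _ h1, hlat _ h2, hinj.ne h3⟩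
  · intro e' he' f' hf' hef
    obtain ⟨e, he, rfl⟩ := Finset.mem_image.1 he'
    obtain ⟨f, hf, rfl⟩ := Finset.mem_image.1 hf'
    have := image_mono (f := fun x : Plane => (N : ℝ)⁻¹ • x)
      (hS2 e he f hf (by rintro rfl; exact hef rfl))
    rw [image_inter hinj, image_inter hinj, image_pair, image_pair] at this
    simp only [hseg]
    exact this
  · rw [Finset.set_biUnion_finset_image]
    simp only [hseg, ← smul_set_iUnion₂]
    have hfr : (N : ℝ) • frontier P.carrier = frontier ((N : ℝ) • P.carrier) :=
      (Homeomorph.smulOfNeZero (N : ℝ) hN0).image_frontier P.carrier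
    rw [← hS3, ← hfr, smul_smul, inv_mul_cancel₀ hN0, one_smul]

/-- A line through two rational points, as the zero set of a rational functional. -/
theorem exists_ratAff_eq_cross {p q : Plane} (hp : p ∈ rationalPoints)
    (hq : q ∈ rationalPoints) : ∃ c, ∀ y, ratAff c y = cross (q - p) (y - p) := by
  obtain ⟨r, rfl⟩ := hp
  obtain ⟨s, rfl⟩ := hq
  refine ⟨(-(s 1 - r 1), s 0 - r 0, (s 1 - r 1) * r 0 - (s 0 - r 0) * r 1), fun y => ?_⟩
  simp only [ratAff, cross, Pi.sub_apply]
  push_cast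
  ring

theorem exists_eq_add_smul_of_cross_eq_zero {p q y : Plane} (h : p ≠ q)
    (hy : cross (q - p) (y - p) = 0) : ∃ l : ℝ, y = p + l • (q - p) := by
  have hn := sq_add_sq_pos h
  refine ⟨((y 0 - p 0) * (q 0 - p 0) + (y 1 - p 1) * (q 1 - p 1)) /
    ((q 0 - p 0) ^ 2 + (q 1 - p 1) ^ 2), ?_⟩
  simp only [cross, Pi.sub_apply] at hy
  ext i
  fin_cases i
  · simp only [Fin.zero_eta, Pi.add_apply, Pi.smul_apply, Pi.sub_apply, smul_eq_mul]
    field_simp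
    linear_combination (-(q 1 - p 1)) * hy
  · simp only [Fin.mk_one, Pi.add_apply, Pi.smul_apply, Pi.sub_apply, smul_eq_mul]
    field_simp
    linear_combination (q 0 - p 0) * hy

/-- A minimal segment that meets a lattice segment in an irrational point is contained in it: both
are on the same line, and the end points of the lattice segment are not inside the minimal one. -/
theorem IsMinimalSegment.segment_subset {d : ℕ} {p q s₁ s₂ : Plane}
    (h : IsMinimalSegment d p q) (hp : p ∈ lattice d) (hq : q ∈ lattice d)
    (h₁ : s₁ ∈ lattice d) (h₂ : s₂ ∈ lattice d) (hs : s₁ ≠ s₂) {t : ℝ} (ht : Irrational t)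
    (ht01 : t ∈ Ioo 0 1) (hx : p + t • (q - p) ∈ segment ℝ s₁ s₂) :
    segment ℝ p q ⊆ segment ℝ s₁ s₂ := by
  have hr := lattice_subset_rationalPoints d
  obtain ⟨c, hc⟩ := exists_ratAff_eq_cross (hr h₁) (hr h₂)
  obtain ⟨hcp, hcq⟩ := ratAff_eq_zero_of_irrational (hr hp) (hr hq) ht
    ((hc _).trans (cross_eq_zero_of_mem_segment hx))
  obtain ⟨α, hα⟩ := exists_eq_add_smul_of_cross_eq_zero hs ((hc p).symm.trans hcp)
  obtain ⟨β, hβ⟩ := exists_eq_add_smul_of_cross_eq_zero hs ((hc q).symm.trans hcq)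
  have hx' : p + t • (q - p) = s₁ + (α + t * (β - α)) • (s₂ - s₁) := by
    rw [hα, hβ]; module
  have hinj : Function.Injective fun l : ℝ => s₁ + l • (s₂ - s₁) := fun l m hlm =>
    smul_left_injective ℝ (sub_ne_zero.2 hs.symm) (add_left_cancel hlm)
  obtain ⟨h0, h1⟩ : α + t * (β - α) ∈ Icc (0 : ℝ) 1 := by
    rw [segment_eq_image'] at hx
    obtain ⟨m, hm, hm'⟩ := hx
    have := hinj (hm'.trans hx')
    exact this ▸ hm
  obtain ⟨ht0, ht1⟩ := ht01
  -- No lattice point of the line has its parameter strictly between `α` and `β`.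
  have hno : ∀ m : ℝ, s₁ + m • (s₂ - s₁) ∈ lattice d → ¬(α < m ∧ m < β) ∧ ¬(β < m ∧ m < α) := by
    intro m hm
    have hmem : ∀ θ ∈ Ioo (0 : ℝ) 1, m = α + θ * (β - α) → False := by
      rintro θ hθ rfl
      refine h.notMem_lattice ?_ hm
      rw [openSegment_eq_image']
      refine ⟨θ, hθ, ?_⟩
      simp only [hα, hβ]
      module
    constructor
    · rintro ⟨ha, hb⟩
      have hab : 0 < β - α := by linarith
      refine hmem ((m - α) / (β - α)) ⟨div_pos (by linarith) hab, ?_⟩ (by field_simp; ring)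
      rw [div_lt_one hab]; linarith
    · rintro ⟨ha, hb⟩
      have hab : 0 < α - β := by linarith
      refine hmem ((α - m) / (α - β)) ⟨div_pos (by linarith) hab, ?_⟩ (by field_simp; ring)
      rw [div_lt_one hab]; linarith
  have hno0 := hno 0 (by simpa using h₁)
  have hno1 := hno 1 (by simpa using h₂)
  have hmem : ∀ m ∈ Icc (0 : ℝ) 1, s₁ + m • (s₂ - s₁) ∈ segment ℝ s₁ s₂ := fun m hm => by
    rw [segment_eq_image']; exact ⟨m, hm, rfl⟩
  have hαβ : α ∈ Icc (0 : ℝ) 1 ∧ β ∈ Icc (0 : ℝ) 1 := by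
    refine ⟨⟨?_, ?_⟩, ?_, ?_⟩ <;> by_contra! hlt
    · exact hno0.1 ⟨hlt, by nlinarith⟩
    · exact hno1.2 ⟨by nlinarith, hlt⟩
    · exact hno0.2 ⟨hlt, by nlinarith⟩
    · exact hno1.1 ⟨by nlinarith, hlt⟩
  exact (convex_segment s₁ s₂).segment_subset (hα ▸ hmem α hαβ.1) (hβ ▸ hmem β hαβ.2)

/-- Near the relatively interior points of a minimal segment in an edge, the boundary of a polygon
is contained in the line of the segment. -/
theorem eventually_cross_eq_zero_of_mem_frontier {d : ℕ} {P : Set Plane}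
    {S : Finset (Plane × Plane)} (hS : ∀ e ∈ S, e.1 ∈ lattice d ∧ e.2 ∈ lattice d ∧ e.1 ≠ e.2)
    (hS' : ∀ e ∈ S, ∀ f ∈ S, e ≠ f →
      segment ℝ e.1 e.2 ∩ segment ℝ f.1 f.2 ⊆ {e.1, e.2} ∩ {f.1, f.2})
    (hP : frontier P = ⋃ e ∈ S, segment ℝ e.1 e.2) {p q : Plane} (h : IsMinimalSegment d p q)
    {s : Plane × Plane} (hs : s ∈ S) (hsub : segment ℝ p q ⊆ segment ℝ s.1 s.2) {x : Plane}
    (hx : x ∈ openSegment ℝ p q) :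
    ∀ᶠ y in 𝓝 x, y ∈ frontier P → cross (q - p) (y - p) = 0 := by
  have hall : ∀ᶠ y in 𝓝 x, ∀ f ∈ S, y ∈ segment ℝ f.1 f.2 → cross (q - p) (y - p) = 0 := by
    refine (Filter.eventually_all_finset S).2 fun f hf => ?_
    by_cases hfs : f = s
    · subst hfs
      have hp := hsub (left_mem_segment ℝ p q)
      have hq := hsub (right_mem_segment ℝ p q)
      rw [segment_eq_image'] at hp hq
      obtain ⟨α, -, rfl⟩ := hp
      obtain ⟨β, -, rfl⟩ := hq
      refine Eventually.of_forall fun y hy => ?_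
      rw [segment_eq_image'] at hy
      obtain ⟨γ, -, rfl⟩ := hy
      simp only [cross, Pi.sub_apply, Pi.add_apply, Pi.smul_apply, smul_eq_mul]
      ring
    · have hxf : x ∉ segment ℝ f.1 f.2 := by
        intro hxf
        have hxs := (hS' f hf s hs hfs
          ⟨hxf, hsub (openSegment_subset_segment ℝ p q hx)⟩).2
        refine h.notMem_lattice hx ?_
        rcases hxs with rfl | rfl
        exacts [(hS s hs).1, (hS s hs).2.1]
      have hcl : IsClosed (segment ℝ f.1 f.2) := by
        rw [segment_eq_image']
        exact (isCompact_Icc.image (by fun_prop)).isClosed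
      filter_upwards [hcl.isOpen_compl.mem_nhds hxf] with y hy hy'
      exact absurd hy' hy
  filter_upwards [hall] with y hy hyP
  rw [hP] at hyP
  obtain ⟨f, hf, hyf⟩ := mem_iUnion₂.1 hyP
  exact hy f hf hyf

section LocalSides

variable {P : Set Plane} {p q x : Plane}

/-- If near `x` the boundary of `P` is contained in the line through `p` and `q`, then the left side
of the line near `x` is either inside or outside `P`. -/
theorem eventually_mem_interior_or_compl (hP : IsClosed P)
    (hloc : ∀ᶠ y in 𝓝 x, y ∈ frontier P → cross (q - p) (y - p) = 0) :
    (∀ᶠ y in 𝓝[leftSide p q] x, y ∈ interior P) ∨ ∀ᶠ y in 𝓝[leftSide p q] x, y ∈ Pᶜ := by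
  obtain ⟨r, hr, hball⟩ := Metric.eventually_nhds_iff_ball.1 hloc
  have hmem : Metric.ball x r ∩ leftSide p q ∈ 𝓝[leftSide p q] x :=
    inter_mem (mem_nhdsWithin_of_mem_nhds (Metric.ball_mem_nhds x hr)) self_mem_nhdsWithin
  have hpre : IsPreconnected (Metric.ball x r ∩ leftSide p q) :=
    ((convex_ball x r).inter (convex_leftSide p q)).isPreconnected
  have hcover : Metric.ball x r ∩ leftSide p q ⊆ interior P ∪ Pᶜ := by
    rintro y ⟨hy, hyl⟩
    by_contra hno
    rw [mem_union, not_or] at hno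
    have hyf : y ∈ frontier P := ⟨subset_closure (not_notMem.1 hno.2), hno.1⟩
    have hz := hball y hy hyf
    simp only [leftSide, mem_ofPred_eq, hz, lt_irrefl] at hyl
  rcases hpre.subset_or_subset isOpen_interior hP.isOpen_compl
    (disjoint_compl_right.mono_left interior_subset) hcover with h | h
  · exact Or.inl (mem_of_superset hmem h)
  · exact Or.inr (mem_of_superset hmem h)

theorem eventually_of_both_sides {A : Plane → Prop}
    (hl : ∀ᶠ y in 𝓝[leftSide p q] x, A y) (hr : ∀ᶠ y in 𝓝[leftSide q p] x, A y) :
    ∀ᶠ y in 𝓝 x, cross (q - p) (y - p) ≠ 0 → A y := by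
  filter_upwards [eventually_nhdsWithin_iff.1 hl, eventually_nhdsWithin_iff.1 hr] with y h1 h2 hy
  rcases hy.lt_or_gt with h | h
  · exact h2 (mem_leftSide_swap.2 h)
  · exact h1 h

/-- A boundary point of a polygon does not have the outside on both sides. -/
theorem not_both_sides_compl (h : p ≠ q) (hP : closure (interior P) = P) (hx : x ∈ P)
    (hl : ∀ᶠ y in 𝓝[leftSide p q] x, y ∈ Pᶜ) (hr : ∀ᶠ y in 𝓝[leftSide q p] x, y ∈ Pᶜ) :
    False := by
  rw [← hP, mem_closure_iff_frequently] at hx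
  obtain ⟨z, hz, hev⟩ :=
    (hx.and_eventually (eventually_of_both_sides hl hr).eventually_nhds).exists
  have hline : ∀ᶠ y in 𝓝 z, cross (q - p) (y - p) = 0 := by
    filter_upwards [hev, isOpen_interior.mem_nhds hz] with y hy hyP
    by_contra hc
    exact hy hc (interior_subset hyP)
  have := neBot_leftSide h hline.self_of_nhds
  obtain ⟨y, hy, hy'⟩ := ((hline.filter_mono nhdsWithin_le_nhds).and
    (self_mem_nhdsWithin : leftSide p q ∈ 𝓝[leftSide p q] z)).exists
  exact absurd hy (ne_of_gt hy')

/-- A boundary point of a closed set does not have the set on both sides. -/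
theorem not_both_sides_mem (h : p ≠ q) (hP : IsClosed P) (hx : x ∈ frontier P)
    (hl : ∀ᶠ y in 𝓝[leftSide p q] x, y ∈ P) (hr : ∀ᶠ y in 𝓝[leftSide q p] x, y ∈ P) :
    False := by
  refine hx.2 (mem_interior_iff_mem_nhds.2 ?_)
  filter_upwards [(eventually_of_both_sides hl hr).eventually_nhds] with z hz
  by_cases hc : cross (q - p) (z - p) = 0
  · have := neBot_leftSide h hc
    rw [← hP.closure_eq]
    refine mem_closure_of_frequently_of_tendsto (f := id) (b := 𝓝[leftSide p q] z) ?_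
      (tendsto_id'.2 nhdsWithin_le_nhds)
    refine Eventually.frequently ?_
    filter_upwards [hz.filter_mono nhdsWithin_le_nhds, self_mem_nhdsWithin] with y hy hyl
    exact hy (ne_of_gt hyl)
  · exact hz.self_of_nhds hc

/-- The left side of a segment does not change between inside and outside along the segment. -/
theorem sides_constant (h : p ≠ q) (hP : IsClosed P)
    (hloc : ∀ x ∈ openSegment ℝ p q,
      ∀ᶠ y in 𝓝 x, y ∈ frontier P → cross (q - p) (y - p) = 0) :
    (∀ x ∈ openSegment ℝ p q, ∀ᶠ y in 𝓝[leftSide p q] x, y ∈ interior P) ∨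
      ∀ x ∈ openSegment ℝ p q, ∀ᶠ y in 𝓝[leftSide p q] x, y ∈ Pᶜ := by
  have hopen : ∀ A : Set Plane, IsOpen {x | ∀ᶠ y in 𝓝[leftSide p q] x, y ∈ A} := fun A =>
    isOpen_iff_mem_nhds.2 fun x hx => eventually_nhds_nhdsWithin.2 hx
  have hpre : IsPreconnected (openSegment ℝ p q) := (convex_openSegment p q).isPreconnected
  by_contra hno
  rw [not_or] at hno
  simp only [not_forall] at hno
  obtain ⟨⟨a, ha, ha'⟩, b, hb, hb'⟩ := hno
  obtain ⟨z, hz, hzi, hzc⟩ := hpre _ _ (hopen (interior P)) (hopen Pᶜ)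
    (fun x hx => eventually_mem_interior_or_compl hP (hloc x hx))
    ⟨b, hb, (eventually_mem_interior_or_compl hP (hloc b hb)).resolve_right hb'⟩
    ⟨a, ha, (eventually_mem_interior_or_compl hP (hloc a ha)).resolve_left ha'⟩
  have := neBot_leftSide h
    (cross_eq_zero_of_mem_segment (openSegment_subset_segment ℝ p q hz))
  simp only [mem_ofPred_eq] at hzi hzc
  obtain ⟨y, hy, hy'⟩ := (hzi.and hzc).exists
  exact hy' (interior_subset hy)

end LocalSides

theorem cross_eq_zero_of_mem_openSegment_symm {p q x : Plane} (hx : x ∈ openSegment ℝ p q) :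
    cross (p - q) (x - q) = 0 :=
  cross_eq_zero_of_mem_segment (segment_symm ℝ p q ▸ openSegment_subset_segment ℝ p q hx)

/-- At an irrational point of a minimal segment, the indicator function of a polygon drops towards
the left exactly if the reversed segment belongs to the oriented boundary. -/
theorem sideJump_polygon {d : ℕ} {P : Set Plane} (hP : IsPolygonOver (lattice d) P)
    {a b : Fin 2 → ℤ} (h : IsMinimalSegment d (latticePoint d a) (latticePoint d b)) {t : ℝ}
    (ht : Irrational t) (ht01 : t ∈ Ioo 0 1) :
    sideJump P (latticePoint d a) (latticePoint d b)
      (latticePoint d a + t • (latticePoint d b - latticePoint d a)) =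
      open Classical in if (b, a) ∈ boundaryEdges d P then -1 else 0 := by
  obtain ⟨hcomp, hreg, S, hS, hS', hfr⟩ := hP
  have ha : latticePoint d a ∈ lattice d := ⟨a, rfl⟩
  have hb : latticePoint d b ∈ lattice d := ⟨b, rfl⟩
  have hba : (b, a) ∈ boundaryEdges d P ↔
      IsMinimalSegment d (latticePoint d b) (latticePoint d a) ∧
      segment ℝ (latticePoint d b) (latticePoint d a) ⊆ frontier P ∧
      LiesToLeft P (latticePoint d b) (latticePoint d a) := Iff.rfl
  rw [segment_symm] at hba
  generalize latticePoint d a = p at *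
  generalize latticePoint d b = q at *
  set x := p + t • (q - p) with hxdef
  have hx : x ∈ openSegment ℝ p q := by
    rw [openSegment_eq_image']; exact ⟨t, ht01, rfl⟩
  have hxs := openSegment_subset_segment ℝ p q hx
  have hx0 : cross (q - p) (x - p) = 0 := cross_eq_zero_of_mem_segment hxs
  have hx0' := cross_eq_zero_of_mem_openSegment_symm hx
  have hcl := hcomp.isClosed
  by_cases hxf : x ∈ frontier P
  · have hxf' := hxf
    rw [hfr] at hxf'
    obtain ⟨s, hs, hxs'⟩ := mem_iUnion₂.1 hxf'
    obtain ⟨hs1, hs2, hs12⟩ := hS s hs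
    have hsub := h.segment_subset ha hb hs1 hs2 hs12 ht ht01 hxs'
    have hsubf : segment ℝ p q ⊆ frontier P := by
      rw [hfr]; exact hsub.trans (subset_biUnion_of_mem (u := fun e : Plane × Plane =>
        segment ℝ e.1 e.2) hs)
    have hloc : ∀ y ∈ openSegment ℝ p q,
        ∀ᶠ z in 𝓝 y, z ∈ frontier P → cross (q - p) (z - p) = 0 := fun y hy =>
      eventually_cross_eq_zero_of_mem_frontier hS hS' hfr h hs hsub hy
    have hloc' : ∀ y ∈ openSegment ℝ q p,
        ∀ᶠ z in 𝓝 y, z ∈ frontier P → cross (p - q) (z - q) = 0 := fun y hy =>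
      (hloc y (openSegment_symm ℝ p q ▸ hy)).mono fun z hz hzf => by
        rw [cross_swap, hz hzf, neg_zero]
    have hxP : x ∈ P := hcl.frontier_subset hxf
    have hpure : filterValue (pure x) P = 1 := filterValue_of_eventually (by simpa using hxP)
    have := neBot_leftSide h.1 hx0
    rcases sides_constant h.1 hcl hloc with hin | hout
    · have hinx := (hin x hx).mono fun y hy => interior_subset hy
      rw [if_neg, sideJump, hpure, filterValue_of_eventually hinx, sub_self]
      intro hB
      have hleft := (hba.1 hB).2.2 x (openSegment_symm ℝ p q ▸ hx)
      rcases sides_constant h.1.symm hcl hloc' with hin' | hout'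
      · exact not_both_sides_mem h.1 hcl hxf hinx
          ((hin' x (openSegment_symm ℝ p q ▸ hx)).mono fun y hy => interior_subset hy)
      · obtain ⟨ε, h1, h2⟩ := (hleft.and ((tendsto_add_smul_rot h.1.symm hx0').eventually
          (hout' x (openSegment_symm ℝ p q ▸ hx)))).exists
        exact h2 (interior_subset h1)
    · rw [if_pos, sideJump, hpure, filterValue_of_eventually_not (hout x hx), zero_sub]
      rcases sides_constant h.1.symm hcl hloc' with hin' | hout'
      · refine hba.2 ⟨h.symm, hsubf, fun y hy => ?_⟩
        have hy0 := cross_eq_zero_of_mem_openSegment_symm (openSegment_symm ℝ q p ▸ hy)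
        exact (tendsto_add_smul_rot h.1.symm hy0).eventually (hin' y hy)
      · exact (not_both_sides_compl h.1 hreg hxP (hout x hx)
          (hout' x (openSegment_symm ℝ p q ▸ hx))).elim
  · rw [if_neg fun hB => hxf ((hba.1 hB).2.1 hxs), sideJump_eq_zero h.1 hx0]
    by_cases hxP : x ∈ P
    · have : x ∈ interior P := by
        by_contra hni
        exact hxf ⟨subset_closure hxP, hni⟩
      filter_upwards [isOpen_interior.mem_nhds this] with y hy
      exact iff_of_true (interior_subset hy) hxP
    · filter_upwards [hcl.isOpen_compl.mem_nhds hxP] with y hy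
      exact iff_of_false hy hxP

/-! ### The weighted number of jumps -/

/-- The contribution of the segment `e` to `weightedJumps`: if `e` is minimal, the jumps of the
indicator function of `X` towards both sides at the point with parameter `t`, weighted by `f` at
the weight of `e` on the left side and of the reversed segment on the right side. -/
def edgeTerm (d : ℕ) (t : ℝ) (f : ZMod d → ℤ) (X : Set Plane)
    (e : (Fin 2 → ℤ) × (Fin 2 → ℤ)) : ℤ :=
  open Classical in
  if IsMinimalSegment d (latticePoint d e.1) (latticePoint d e.2) then
    f (edgeWeight d e) *
        sideJump X (latticePoint d e.1) (latticePoint d e.2) (edgePoint d t e) +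
      f (-edgeWeight d e) *
        sideJump X (latticePoint d e.2) (latticePoint d e.1) (edgePoint d t e)
  else 0

/-- The weighted number of jumps of the indicator function of `X` across all oriented minimal
segments. Every minimal segment is counted in both orientations, at the points with parameter `t`
and `1 - t`. -/
def weightedJumps (d : ℕ) (t : ℝ) (f : ZMod d → ℤ) (X : Set Plane) : ℤ :=
  ∑ᶠ e, edgeTerm d t f X e

theorem edgePoint_mem_segment (d : ℕ) {t : ℝ} (ht01 : t ∈ Ioo 0 1) (e : (Fin 2 → ℤ) × (Fin 2 → ℤ)) :
    edgePoint d t e ∈ segment ℝ (latticePoint d e.1) (latticePoint d e.2) := by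
  rw [segment_eq_image']
  exact ⟨t, Ioo_subset_Icc_self ht01, rfl⟩

theorem edgePoint_eq_reversed (d : ℕ) (t : ℝ) (e : (Fin 2 → ℤ) × (Fin 2 → ℤ)) :
    edgePoint d t e =
      latticePoint d e.2 + (1 - t) • (latticePoint d e.1 - latticePoint d e.2) := by
  rw [edgePoint]; module

theorem irrational_one_sub {t : ℝ} (ht : Irrational t) : Irrational (1 - t) := by
  simpa using ht.ratCast_sub 1

theorem one_sub_mem_Ioo {t : ℝ} (ht01 : t ∈ Ioo (0 : ℝ) 1) : 1 - t ∈ Ioo (0 : ℝ) 1 :=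
  ⟨by linarith [ht01.2], by linarith [ht01.1]⟩

section

variable {d : ℕ} {t : ℝ} (f : ZMod d → ℤ)

theorem edgeTerm_iUnion {ι : Type*} [Fintype ι] {T : ι → Set Plane}
    (hT : ∀ i, SignDetermined (T i)) (hd : Pairwise fun i j => Disjoint (T i) (T j))
    (ht : Irrational t) (ht01 : t ∈ Ioo 0 1) (e : (Fin 2 → ℤ) × (Fin 2 → ℤ)) :
    edgeTerm d t f (⋃ i, T i) e = ∑ i, edgeTerm d t f (T i) e := by
  by_cases hmin : IsMinimalSegment d (latticePoint d e.1) (latticePoint d e.2)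
  · have hx := edgePoint_mem_segment d ht01 e
    have hx' := hx
    rw [segment_symm] at hx'
    have h1 := latticePoint_mem_rationalPoints d e.1
    have h2 := latticePoint_mem_rationalPoints d e.2
    simp only [edgeTerm, if_pos hmin]
    rw [Finset.sum_add_distrib, ← Finset.mul_sum, ← Finset.mul_sum,
      sideJump_iUnion hmin.1 (cross_eq_zero_of_mem_segment hx) hd
        fun i => (hT i).decides h1 h2 hmin.1 ht,
      sideJump_iUnion hmin.1.symm
        (cross_eq_zero_of_mem_segment hx') hd fun i => ?_]
    rw [edgePoint_eq_reversed]
    exact (hT i).decides h2 h1 hmin.1.symm (irrational_one_sub ht)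
  · simp only [edgeTerm, if_neg hmin, Finset.sum_const_zero]

variable [NeZero d]

theorem finite_support_edgeTerm {T : Set Plane} (hT : SignDetermined T)
    (hb : Bornology.IsBounded T) (ht : Irrational t) (ht01 : t ∈ Ioo 0 1) :
    (Function.support (edgeTerm d t f T)).Finite := by
  refine (hT.finite_not_locallyConstant d hb ht ht01).subset fun e he => ?_
  by_cases hmin : IsMinimalSegment d (latticePoint d e.1) (latticePoint d e.2)
  · refine ⟨hmin, fun hc => he ?_⟩
    have hx := edgePoint_mem_segment d ht01 e
    have hx' := hx
    rw [segment_symm] at hx'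
    rw [edgeTerm, if_pos hmin,
      sideJump_eq_zero hmin.1 (cross_eq_zero_of_mem_segment hx) hc,
      sideJump_eq_zero hmin.1.symm (cross_eq_zero_of_mem_segment hx') hc,
      mul_zero, mul_zero, add_zero]
  · exact (he (if_neg hmin)).elim

theorem weightedJumps_iUnion {ι : Type*} [Fintype ι] {T : ι → Set Plane}
    (hT : ∀ i, SignDetermined (T i)) (hb : ∀ i, Bornology.IsBounded (T i))
    (hd : Pairwise fun i j => Disjoint (T i) (T j)) (ht : Irrational t) (ht01 : t ∈ Ioo 0 1) :
    weightedJumps d t f (⋃ i, T i) = ∑ i, weightedJumps d t f (T i) := by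
  simp only [weightedJumps]
  rw [← finsum_sum_comm _ _ fun i _ => finite_support_edgeTerm f (hT i) (hb i) ht ht01]
  exact finsum_congr fun e => edgeTerm_iUnion f hT hd ht ht01 e

/-- Orientation preserving transformations preserve the weights; orientation reversing ones negate
the weights and exchange the two sides. In both cases the terms are preserved. -/
theorem edgeTerm_image (U : GL (Fin 2) ℤ) (v : Fin 2 → ℤ) (X : Set Plane)
    (e : (Fin 2 → ℤ) × (Fin 2 → ℤ)) :
    edgeTerm d t f (gMap U v '' X) (edgeEquiv d U v e) = edgeTerm d t f X e := by
  have h1 : latticePoint d (edgeEquiv d U v e).1 = gMap U v (latticePoint d e.1) :=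
    latticePoint_latticeEquiv d U v e.1
  have h2 : latticePoint d (edgeEquiv d U v e).2 = gMap U v (latticePoint d e.2) :=
    latticePoint_latticeEquiv d U v e.2
  rw [edgeTerm, edgeTerm, edgePoint_edgeEquiv, edgeWeight_edgeEquiv, h1, h2,
    isMinimalSegment_gMap]
  congr 1
  rcases det_eq_one_or_neg_one U with hU | hU
  · simp only [sideJump_image_of_det_eq_one v hU, hU, Int.cast_one, one_mul]
  · simp only [sideJump_image_of_det_eq_neg_one v hU, hU, Int.cast_neg, Int.cast_one, neg_mul,
      one_mul, neg_neg]
    exact add_comm _ _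

theorem weightedJumps_image (U : GL (Fin 2) ℤ) (v : Fin 2 → ℤ) (X : Set Plane) :
    weightedJumps d t f (gMap U v '' X) = weightedJumps d t f X := by
  rw [weightedJumps, ← finsum_comp_equiv (edgeEquiv d U v)]
  exact finsum_congr fun e => edgeTerm_image f U v X e

theorem weightedJumps_eq_of_equidecomposable {P Q : Set Plane} (hP : Bornology.IsBounded P)
    (hQ : Bornology.IsBounded Q) (h : FinRatEquidecomposable P Q) (ht : Irrational t)
    (ht01 : t ∈ Ioo 0 1) : weightedJumps d t f P = weightedJumps d t f Q := by
  obtain ⟨r, T, U, v, hT, hd, rfl, hd', rfl⟩ := h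
  rw [weightedJumps_iUnion f (fun i => (hT i).signDetermined)
      (fun i => hP.subset (subset_iUnion T i)) hd ht ht01,
    weightedJumps_iUnion f (fun i => ((hT i).gMap (U i) (v i)).signDetermined)
      (fun i => hQ.subset (subset_iUnion (fun i => gMap (U i) (v i) '' T i) i)) hd' ht ht01]
  exact Finset.sum_congr rfl fun i _ => (weightedJumps_image f (U i) (v i) (T i)).symm

/-- A polygon has no jump towards its inside and the jump `-1` towards its outside. -/
theorem weightedJumps_polygon {P : Set Plane} (hP : IsPolygonOver (lattice d) P)
    (ht : Irrational t) (ht01 : t ∈ Ioo 0 1) :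
    weightedJumps d t f P =
      -2 * ∑ e ∈ (finite_boundaryEdges d hP.1).toFinset, f (-edgeWeight d e) := by
  classical
  set F : (Fin 2 → ℤ) × (Fin 2 → ℤ) → ℤ :=
    fun e => if e ∈ boundaryEdges d P then f (-edgeWeight d e) else 0 with hF
  have hterm : ∀ e, edgeTerm d t f P e = -(F (Equiv.prodComm _ _ e) + F e) := by
    rintro ⟨a, b⟩
    by_cases hmin : IsMinimalSegment d (latticePoint d a) (latticePoint d b)
    · rw [edgeTerm, if_pos hmin]
      have h1 := sideJump_polygon hP hmin ht ht01
      have h2 := sideJump_polygon hP hmin.symm (irrational_one_sub ht) (one_sub_mem_Ioo ht01)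
      rw [← edgePoint_eq_reversed d t (a, b)] at h2
      have hw : edgeWeight d (b, a) = -edgeWeight d (a, b) := edgeWeight_swap d (a, b)
      simp only [edgePoint] at h2 ⊢
      rw [h1, h2]
      simp only [hF, Equiv.prodComm_apply, Prod.swap_prod_mk, hw, neg_neg]
      split_ifs <;> ring
    · have h1 : (a, b) ∉ boundaryEdges d P := fun h => hmin h.1
      have h2 : (b, a) ∉ boundaryEdges d P := fun h => hmin h.1.symm
      simp [edgeTerm, hmin, hF, h1, h2]
  have hsupp : Function.support F ⊆ (finite_boundaryEdges d hP.1).toFinset := by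
    intro e he
    rw [Finite.coe_toFinset]
    by_contra hno
    exact he (if_neg hno)
  have hfin : (Function.support F).Finite := (Finset.finite_toSet _).subset hsupp
  have hfin' : (Function.support fun e => F (Equiv.prodComm _ _ e)).Finite :=
    hfin.preimage (Equiv.prodComm _ _).injective.injOn
  rw [weightedJumps, finsum_congr hterm, finsum_neg_distrib, finsum_add_distrib hfin' hfin,
    finsum_comp_equiv, finsum_eq_sum_of_support_subset F hsupp,
    Finset.sum_congr rfl fun e he => if_pos ((Finite.mem_toFinset _).1 he)]
  ring

end

end Equidecomp

end

theorem theorem3 (d : ℕ) [NeZero d] (P Q : Equidecomp.RationalPolygon)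
    (hP : P.denominator ∣ d) (hQ : Q.denominator ∣ d)
    (hPQ : Equidecomp.FinRatEquidecomposable P.carrier Q.carrier) :
    P.weight d = Q.weight d := by
  classical
  ext c
  obtain ⟨t, ht, h0, h1⟩ := exists_irrational_btwn (zero_lt_one (α := ℝ))
  have hcount : ∀ R : Equidecomp.RationalPolygon, R.denominator ∣ d →
      Equidecomp.weightedJumps d t (fun w => if c = -w then 1 else 0) R.carrier =
        -2 * ((R.weight d).count c : ℤ) := by
    intro R hR
    rw [Equidecomp.weightedJumps_polygon _
      (Equidecomp.isPolygonOver_lattice_of_denominator_dvd R hR) ht ⟨h0, h1⟩]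
    simp only [neg_neg]
    rw [Finset.sum_boole, Equidecomp.RationalPolygon.weight, Multiset.count_map]
    rfl
  have := Equidecomp.weightedJumps_eq_of_equidecomposable (d := d)
    (fun w => if c = -w then 1 else 0) P.isPolygon.1.isBounded Q.isPolygon.1.isBounded hPQ ht
    ⟨h0, h1⟩
  rw [hcount P hP, hcount Q hQ] at this
  omega
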